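/- Let $K$ be an algebraically closed field and let $Q=(Q_0,Q_1)$ be a finite quiver whose underlying graph is the Dynkin diagram $\mathbb{A}_n$ (the path with $n$ vertices), for some positive integer $n$; let $\Lambda=KQ$ be its path algebra (a finite-dimensional hereditary $K$-algebra), where for paths $p,q$ the product $pq$ is "first $p$, then $q$" if $p$ ends where $q$ starts, and $0$ otherwise. For $a\in Q_0$ let $a^+$ and $a^-$ be the sets of arrows starting and ending in $a$, respectively. For a module $M$ let $\mathrm{rad}(M)$ be the intersection of its maximal submodules, $\mathrm{rad}^0(M)=M$ and $\mathrm{rad}^{i+1}(M)=\mathrm{rad}(\mathrm{rad}^i(M))$. Call $M$ uniserial ($1$-factor serial) if it has a unique composition series (so the zero module is uniserial). For $m>1$, call a module $M$ of finite length $l\ge m$ $m$-factor serial if $M/\mathrm{rad}^{l-m}(M)$ is uniserial and $M/\mathrm{rad}^{l-m+1}(M)$ is not uniserial. An artin algebra is called right $m$-Nakayama if every finitely generated indecomposable right module over it is $i$-factor serial for some $1\le i\le m$, and at least one finitely generated indecomposable right module is $m$-factor serial. Then the following hold. (a) If $|a^-|\le 1$ for every $a\in Q_0$ and there is a vertex $b\in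 Q_0$ with $|b^+|=2$, then $\Lambda$ is right $(n-1)$-Nakayama. (b) If there is a vertex $b\in Q_0$ with $|b^-|=2$, then $\Lambda$ is right $n$-Nakayama. -/

import Mathlib

open scoped MulOpposite

universe u v w

section PathAlgebra

open Quiver

/-- The bilinear extension of concatenation of paths: `p ⊗ q ↦ pq`, where `pq` is the path
`p : a → b` followed by the path `q : b → c`. -/
noncomputable def pathConcat (K : Type u) [CommRing K] {V : Type v} [Quiver.{w} V]
    (a b c : V) :
    (Path a b →₀ K) →ₗ[K] (Path b c →₀ K) →ₗ[K] (Path a c →₀ K) :=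
  Finsupp.linearCombination K fun p : Path a b =>
    Finsupp.lmapDomain K K fun q : Path b c => p.comp q

/-- The path algebra `KQ` of a quiver `Q` with vertex set `V`. For finite `V` this is the free
`K`-module on all paths of `Q` (including the trivial ones), sorted by source and target:
`KQ = ⨁ a b, K{paths from a to b}`. -/
def PathAlgebra (K : Type u) [CommRing K] (V : Type v) [Quiver.{w} V] : Type (max u v w) :=
  ∀ a b : V, Path a b →₀ K

namespace PathAlgebra

variable {K : Type u} [CommRing K] {V : Type v} [Quiver.{w} V]

theorem pathConcat_single {a b c : V} (p : Path a b) (q : Path b c) (x y : K) :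
    pathConcat K a b c (Finsupp.single p x) (Finsupp.single q y) =
      Finsupp.single (p.comp q) (x * y) := by
  simp [pathConcat]

theorem pathConcat_assoc {a b c d : V} (f : Path a b →₀ K) (g : Path b c →₀ K)
    (h : Path c d →₀ K) :
    pathConcat K a c d (pathConcat K a b c f g) h =
      pathConcat K a b d f (pathConcat K b c d g h) := by
  induction f using Finsupp.induction_linear with
  | zero => simp
  | add f₁ f₂ h₁ h₂ => simp [h₁, h₂]
  | single p x =>
    induction g using Finsupp.induction_linear with
    | zero => simp
    | add g₁ g₂ h₁ h₂ => simp [h₁, h₂]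
    | single q y =>
      induction h using Finsupp.induction_linear with
      | zero => simp
      | add k₁ k₂ h₁ h₂ => simp [h₁, h₂]
      | single r z => simp only [pathConcat_single, Path.comp_assoc, mul_assoc]

theorem nil_pathConcat {a b : V} (f : Path a b →₀ K) :
    pathConcat K a a b (Finsupp.single Path.nil 1) f = f := by
  induction f using Finsupp.induction_linear with
  | zero => simp
  | add f₁ f₂ h₁ h₂ => simp [h₁, h₂]
  | single p x => simp [pathConcat_single]

theorem pathConcat_nil {a b : V} (f : Path a b →₀ K) :
    pathConcat K a b b f (Finsupp.single Path.nil 1) = f := by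
  induction f using Finsupp.induction_linear with
  | zero => simp
  | add f₁ f₂ h₁ h₂ => simp [h₁, h₂]
  | single p x => simp [pathConcat_single]

noncomputable instance : AddCommGroup (PathAlgebra K V) :=
  inferInstanceAs (AddCommGroup (∀ a b : V, Path a b →₀ K))

noncomputable instance : Module K (PathAlgebra K V) :=
  inferInstanceAs (Module K (∀ a b : V, Path a b →₀ K))

theorem add_apply (f g : PathAlgebra K V) (a b : V) : (f + g) a b = f a b + g a b := rfl

theorem zero_apply (a b : V) : (0 : PathAlgebra K V) a b = 0 := rfl

theorem smul_apply (x : K) (f : PathAlgebra K V) (a b : V) : (x • f) a b = x • f a b := rfl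

/-- The sum of all trivial paths. -/
noncomputable instance : One (PathAlgebra K V) where
  one a b := by
    classical
    exact if h : a = b then Finsupp.single (h ▸ Path.nil) 1 else 0

theorem one_apply_self (a : V) :
    (1 : PathAlgebra K V) a a = Finsupp.single Path.nil 1 :=
  dif_pos rfl

theorem one_apply_ne {a b : V} (h : a ≠ b) : (1 : PathAlgebra K V) a b = 0 :=
  dif_neg h

variable [Fintype V]

/-- The product of two paths is their concatenation if the first one ends where the second one
starts, and zero otherwise. -/
noncomputable instance : Mul (PathAlgebra K V) where
  mul f g a c := ∑ b : V, pathConcat K a b c (f a b) (g b c)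

theorem mul_apply (f g : PathAlgebra K V) (a c : V) :
    (f * g) a c = ∑ b : V, pathConcat K a b c (f a b) (g b c) := rfl

noncomputable instance : Ring (PathAlgebra K V) where
  __ := (inferInstance : AddCommGroup (PathAlgebra K V))
  left_distrib f g h := by
    funext a c
    simp [mul_apply, add_apply, Finset.sum_add_distrib]
  right_distrib f g h := by
    funext a c
    simp [mul_apply, add_apply, Finset.sum_add_distrib]
  zero_mul f := by
    funext a c
    simp [mul_apply, zero_apply]
  mul_zero f := by
    funext a c
    simp [mul_apply, zero_apply]
  mul_assoc f g h := by
    funext a d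
    simp only [mul_apply, map_sum, LinearMap.sum_apply, pathConcat_assoc]
    exact Finset.sum_comm
  one_mul f := by
    funext a c
    rw [mul_apply, Finset.sum_eq_single a, one_apply_self, nil_pathConcat]
    · intro b _ hb
      simp [one_apply_ne hb.symm]
    · simp
  mul_one f := by
    funext a c
    rw [mul_apply, Finset.sum_eq_single c, one_apply_self, pathConcat_nil]
    · intro b _ hb
      simp [one_apply_ne hb]
    · simp

noncomputable instance : Algebra K (PathAlgebra K V) :=
  Algebra.ofModule
    (fun x f g => by
      funext a c
      simp [mul_apply, smul_apply, Finset.smul_sum])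
    (fun x f g => by
      funext a c
      simp [mul_apply, smul_apply, Finset.smul_sum])

end PathAlgebra

/-- The underlying graph of the quiver is the Dynkin diagram `𝔸_n`, the path with `n` vertices:
adjacent vertices are joined by exactly one arrow (in one of the two directions), and there are no
further arrows. -/
def IsTypeA (V : Type v) [Quiver.{w} V] (n : ℕ) : Prop :=
  ∃ e : V ≃ Fin n, ∀ a b : V,
    ((SimpleGraph.pathGraph n).Adj (e a) (e b) → Nonempty (Unique ((a ⟶ b) ⊕ (b ⟶ a)))) ∧
    (¬ (SimpleGraph.pathGraph n).Adj (e a) (e b) → IsEmpty (a ⟶ b))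

end PathAlgebra

section Nakayama

/-- The iterated radical: `rad⁰ M = M` and `radⁱ⁺¹ M = rad (radⁱ M)`, where the radical of a module
is the intersection of its maximal submodules. -/
def radPow (S : Type*) [Ring S] (M : Type*) [AddCommGroup M] [Module S M] : ℕ → Submodule S M
  | 0 => ⊤
  | i + 1 => (Module.jacobson S (radPow S M i)).map (radPow S M i).subtype

/-- A module is uniserial if it has a unique composition series
`0 = M₀ ⊂ M₁ ⊂ ⋯ ⊂ M_l = M`. (The zero module is uniserial, with the series of length `0`.) -/
def IsUniserialModule (S : Type*) [Ring S] (M : Type*) [AddCommGroup M] [Module S M] : Prop :=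
  ∃! s : CompositionSeries (Submodule S M), s.head = ⊥ ∧ s.last = ⊤

/-- `n`-factor serial modules: for `n = 1` these are the uniserial ones; for `n > 1`, the modules
`M` of finite length `l ≥ n` such that `M / rad^{l-n} M` is uniserial and `M / rad^{l-n+1} M` is
not. -/
def IsFactorSerial (S : Type*) [Ring S] (M : Type*) [AddCommGroup M] [Module S M] (n : ℕ) :
    Prop :=
  (n = 1 ∧ IsUniserialModule S M) ∨
  (1 < n ∧ ∃ l : ℕ, Module.length S M = l ∧ n ≤ l ∧
    IsUniserialModule S (M ⧸ radPow S M (l - n)) ∧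
    ¬ IsUniserialModule S (M ⧸ radPow S M (l - n + 1)))

/-- A module is indecomposable if it is nonzero and not the direct sum of two nonzero
submodules. -/
def IsIndecomposableModule (S : Type*) [Ring S] (M : Type*) [AddCommGroup M] [Module S M] :
    Prop :=
  Nontrivial M ∧ ∀ A B : Submodule S M, IsCompl A B → A = ⊥ ∨ B = ⊥

/-- An `R`-algebra is an artin algebra if `R` is a commutative artinian ring and the algebra is
finitely generated as an `R`-module. -/
def IsArtinAlgebra (R : Type v) [CommRing R] (L : Type u) [Ring L] [Algebra R L] : Prop :=
  IsArtinianRing R ∧ Module.Finite R L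

/-- Right `n`-Nakayama algebras: artin algebras over which every finitely generated indecomposable
right module is `i`-factor serial for some `1 ≤ i ≤ n`, and some finitely generated indecomposable
right module is `n`-factor serial. Right modules are modules over the opposite ring; every finitely
generated one is isomorphic to one in the universe of the algebra. -/
def IsRightNakayama (R : Type v) [CommRing R] (L : Type u) [Ring L] [Algebra R L] (n : ℕ) : Prop :=
  IsArtinAlgebra R L ∧
  (∀ (M : Type u) [AddCommGroup M] [Module Lᵐᵒᵖ M] [Module.Finite Lᵐᵒᵖ M],
    IsIndecomposableModule Lᵐᵒᵖ M → ∃ i : ℕ, 1 ≤ i ∧ i ≤ n ∧ IsFactorSerial Lᵐᵒᵖ M i) ∧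
  (∃ (M : Type u) (_ : AddCommGroup M) (_ : Module Lᵐᵒᵖ M),
    Module.Finite Lᵐᵒᵖ M ∧ IsIndecomposableModule Lᵐᵒᵖ M ∧ IsFactorSerial Lᵐᵒᵖ M n)

end Nakayama

open Quiver

/-! ### Zigzags of linear relations and chains of subspaces. -/

section FlagExtension

variable {K M : Type*} [Field K] [AddCommGroup M] [Module K M]

/-- The image of a subspace under a linear relation. -/
def relImage (L : Submodule K (M × M)) (F : Submodule K M) : Submodule K M :=
  (L ⊓ F.comap (LinearMap.fst K M M)).map (LinearMap.snd K M M)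

theorem mem_relImage {L : Submodule K (M × M)} {F : Submodule K M} {y : M} :
    y ∈ relImage L F ↔ ∃ x ∈ F, (x, y) ∈ L := by
  simp only [relImage, Submodule.mem_map, Submodule.mem_inf, Submodule.mem_comap,
    LinearMap.fst_apply, LinearMap.snd_apply, Prod.exists]
  constructor
  · rintro ⟨a, b, ⟨h, h'⟩, rfl⟩
    exact ⟨a, h', h⟩
  · rintro ⟨x, hx, h⟩
    exact ⟨x, y, ⟨h, hx⟩, rfl⟩

theorem relImage_mono (L : Submodule K (M × M)) : Monotone (relImage L) := by
  intro F G h y hy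
  obtain ⟨x, hx, hxy⟩ := mem_relImage.mp hy
  exact mem_relImage.mpr ⟨x, h hx, hxy⟩

/-- The chain spanned by the image of a chain under a linear relation with values in `W`. -/
theorem isChain_relImage {C : Set (Submodule K M)} (hC : IsChain (· ≤ ·) C)
    (L : Submodule K (M × M)) (W : Submodule K M) (hL : ∀ p ∈ L, p.2 ∈ W) :
    IsChain (· ≤ ·) (insert ⊥ (insert ⊤ (insert W (relImage L '' C)))) := by
  have h : ∀ F, relImage L F ≤ W := fun F y hy => by
    obtain ⟨x, -, hxy⟩ := mem_relImage.mp hy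
    exact hL _ hxy
  refine (((hC.image_of_map_rel _ _ _ fun _ _ h => relImage_mono L h).insert ?_).insert ?_).insert ?_
  · rintro _ ⟨F, -, rfl⟩ -
    exact Or.inr (h F)
  · exact fun _ _ _ => Or.inr le_top
  · exact fun _ _ _ => Or.inl bot_le

variable [FiniteDimensional K M]

/-- A linear map on `D` that preserves a chain `C` of subspaces and has its graph inside a linear
relation `R` extends to the larger space `T`, if `R` is total on `T ⊓ F` with values in `F` for all
members `F` of the chain. -/
theorem exists_extend_preserving_chain {C : Set (Submodule K M)} (hC : IsChain (· ≤ ·) C)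
    (hT : ⊤ ∈ C) (T : Submodule K M) (R : Submodule K (M × M))
    (hR : ∀ F ∈ C, ∀ x ∈ F, x ∈ T → ∃ y ∈ F, (x, y) ∈ R) (D : Submodule K M) (hD : D ≤ T)
    (φ : M →ₗ[K] M) (h₁ : ∀ x ∈ D, (x, φ x) ∈ R) (h₂ : ∀ F ∈ C, ∀ x ∈ D, x ∈ F → φ x ∈ F) :
    ∃ ψ : M →ₗ[K] M, (∀ x ∈ D, ψ x = φ x) ∧ (∀ x ∈ T, (x, ψ x) ∈ R) ∧
      ∀ F ∈ C, ∀ x ∈ T, x ∈ F → ψ x ∈ F := by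
  induction D using WellFoundedGT.induction generalizing φ with
  | ind D ih =>
    by_cases hTD : T ≤ D
    · exact ⟨φ, fun _ _ => rfl, fun x hx => h₁ x (hTD hx), fun F hF x hx => h₂ F hF x (hTD hx)⟩
    -- The new vector `x` is taken in the smallest member `F` that still contributes to `T` outside
    -- `D`. Members above `F` contain the chosen image `y`; members below `F` meet `T` inside `D`,
    -- so they do not see the extension.
    obtain ⟨F, ⟨hFC, hF⟩, hmin⟩ := WellFounded.has_min (wellFounded_lt (α := Submodule K M))
      {F | F ∈ C ∧ ¬ F ⊓ T ≤ D} ⟨⊤, hT, by simpa using hTD⟩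
    obtain ⟨x, ⟨hxF, hxT⟩, hxD⟩ := SetLike.not_le_iff_exists.mp hF
    obtain ⟨y, hyF, hxy⟩ := hR F hFC x hxF hxT
    obtain ⟨ξ, hξx, hξD⟩ := Submodule.exists_le_ker_of_notMem hxD
    set c := ξ x with hc
    let φ' : M →ₗ[K] M := φ + (c⁻¹ • ξ).smulRight (y - φ x)
    have hφD : ∀ d ∈ D, φ' d = φ d := by
      intro d hd
      have : ξ d = 0 := hξD hd
      simp [φ', this]
    have hφx : φ' x = y := by
      simp [φ', ← hc, inv_mul_cancel₀ hξx]
    have hlt : D < D ⊔ K ∙ x := by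
      refine lt_of_le_of_ne le_sup_left fun h => hxD ?_
      rw [h]
      exact Submodule.mem_sup_right (Submodule.mem_span_singleton_self x)
    have key : ∀ z ∈ D ⊔ K ∙ x, ∃ d ∈ D, ∃ a : K, z = d + a • x ∧ φ' z = φ d + a • y := by
      intro z hz
      obtain ⟨d, hd, e, he, rfl⟩ := Submodule.mem_sup.mp hz
      obtain ⟨a, rfl⟩ := Submodule.mem_span_singleton.mp he
      exact ⟨d, hd, a, rfl, by rw [map_add, map_smul, hφD d hd, hφx]⟩
    have h₁' : ∀ z ∈ D ⊔ K ∙ x, (z, φ' z) ∈ R := by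
      intro z hz
      obtain ⟨d, hd, a, rfl, h⟩ := key z hz
      rw [h]
      exact R.add_mem (h₁ d hd) (R.smul_mem a hxy)
    have h₂' : ∀ F ∈ C, ∀ z ∈ D ⊔ K ∙ x, z ∈ F → φ' z ∈ F := by
      intro G hG z hz hzG
      obtain ⟨d, hd, a, rfl, h⟩ := key z hz
      rw [h]
      by_cases hFG : F ≤ G
      · refine G.add_mem (h₂ G hG d hd ?_) (G.smul_mem a (hFG hyF))
        exact (G.add_mem_iff_left (G.smul_mem a (hFG hxF))).mp hzG
      · have hGF : G < F := lt_of_le_not_ge ((hC.total hG hFC).resolve_right hFG) hFG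
        have hGD : G ⊓ T ≤ D := by
          by_contra h
          exact hmin G ⟨hG, h⟩ hGF
        have hzD := hGD ⟨hzG, T.add_mem (hD hd) (T.smul_mem a hxT)⟩
        have hax : a • x ∈ D := (D.add_mem_iff_right hd).mp hzD
        have ha : a = 0 := by
          by_contra ha
          exact hxD ((D.smul_mem_iff ha).mp hax)
        subst ha
        simp only [zero_smul, add_zero] at hzG ⊢
        exact h₂ G hG d hd hzG
    obtain ⟨ψ, hψ, hψ'⟩ := ih (D ⊔ K ∙ x) hlt
      (sup_le hD ((Submodule.span_singleton_le_iff_mem x T).mpr hxT)) φ' h₁' h₂'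
    refine ⟨ψ, fun d hd => ?_, hψ'⟩
    rw [hψ d (Submodule.mem_sup_left hd), hφD d hd]

/-- Endomorphisms preserving the image of a chain under a linear relation lift along the relation
to endomorphisms preserving the chain. -/
theorem exists_lift_preserving_chain {C : Set (Submodule K M)} (hC : IsChain (· ≤ ·) C)
    (hbot : ⊥ ∈ C) (htop : ⊤ ∈ C) (L : Submodule K (M × M)) (φ : M →ₗ[K] M)
    (hφ : ∀ F ∈ C, ∀ y ∈ relImage L F, φ y ∈ relImage L F) :
    ∃ ψ : M →ₗ[K] M, (∀ F ∈ C, ∀ x ∈ F, ψ x ∈ F) ∧ ∀ p ∈ L, (ψ p.1, φ p.2) ∈ L := by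
  let T : Submodule K M := L.map (LinearMap.fst K M M)
  have hT : ∀ x, x ∈ T ↔ ∃ y, (x, y) ∈ L := fun x => by simp [T]
  -- `R` is the composite relation "back along `L`, apply `φ`, forward to the source again"; a map
  -- with graph in `R` is a lift of `φ`, up to the indeterminacy of `L`.
  let R : Submodule K (M × M) :=
    { carrier := {p | ∃ y, (p.1, y) ∈ L ∧ (p.2, φ y) ∈ L}
      zero_mem' := ⟨0, L.zero_mem, by rw [map_zero]; exact L.zero_mem⟩
      add_mem' := by
        rintro p q ⟨y, h, h'⟩ ⟨z, k, k'⟩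
        exact ⟨y + z, L.add_mem h k, by rw [map_add]; exact L.add_mem h' k'⟩
      smul_mem' := by
        rintro c p ⟨y, h, h'⟩
        exact ⟨c • y, L.smul_mem c h, by rw [map_smul]; exact L.smul_mem c h'⟩ }
  have hR : ∀ p, p ∈ R ↔ ∃ y, (p.1, y) ∈ L ∧ (p.2, φ y) ∈ L := fun _ => Iff.rfl
  obtain ⟨ψ, -, hψR, hψC⟩ := exists_extend_preserving_chain hC htop T R
    (by
      intro F hF x hx hxT
      obtain ⟨y, hy⟩ := (hT x).mp hxT
      obtain ⟨x', hx', h⟩ := mem_relImage.mp (hφ F hF y (mem_relImage.mpr ⟨x, hx, hy⟩))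
      exact ⟨x', hx', y, hy, h⟩) ⊥ bot_le 0
    (by simp only [Submodule.mem_bot, forall_eq]; exact R.zero_mem)
    (by simp +contextual)
  obtain ⟨χ, hχT, -, hχC⟩ := exists_extend_preserving_chain hC htop ⊤ ⊤
    (fun F hF x hx _ => ⟨x, hx, trivial⟩) T le_top ψ (fun _ _ => trivial) hψC
  refine ⟨χ, fun F hF x hx => hχC F hF x trivial hx, ?_⟩
  rintro ⟨x, y⟩ hxy
  have hxT : x ∈ T := (hT x).mpr ⟨y, hxy⟩
  obtain ⟨z, hxz, hψz⟩ := (hR _).mp (hψR x hxT)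
  simp only at hxz hψz ⊢
  rw [hχT x hxT]
  -- `y` and the auxiliary `z` are both related to `x`, so they differ by the indeterminacy
  -- `relImage L ⊥`. Since `⊥` belongs to the chain, `φ` preserves it.
  have hyz : y - z ∈ relImage L ⊥ :=
    mem_relImage.mpr ⟨0, Submodule.zero_mem _, by simpa using L.sub_mem hxy hxz⟩
  obtain ⟨x', hx', h⟩ := mem_relImage.mp (hφ ⊥ hbot _ hyz)
  rw [Submodule.mem_bot] at hx'
  subst hx'
  simpa using L.add_mem hψz h

/-- Every subspace `W k` of a zigzag of linear relations carries a chain such that the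
endomorphisms preserving it extend to the part of the zigzag left of `k`. -/
theorem exists_chain_left (W : ℕ → Submodule K M) (L : ℕ → Submodule K (M × M))
    (hL : ∀ i, ∀ p ∈ L i, p.2 ∈ W (i + 1)) (k : ℕ) :
    ∃ C : Set (Submodule K M), IsChain (· ≤ ·) C ∧ ⊥ ∈ C ∧ ⊤ ∈ C ∧ W k ∈ C ∧
      ∀ φ : M →ₗ[K] M, (∀ F ∈ C, ∀ x ∈ F, φ x ∈ F) → ∃ Φ : ℕ → M →ₗ[K] M, Φ k = φ ∧
        (∀ i ≤ k, ∀ x ∈ W i, Φ i x ∈ W i) ∧ ∀ i < k, ∀ p ∈ L i, (Φ i p.1, Φ (i + 1) p.2) ∈ L i := by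
  induction k with
  | zero =>
    refine ⟨{⊥, ⊤, W 0}, ?_, by simp, by simp, by simp, fun φ hφ => ⟨fun _ => φ, rfl, ?_, by simp⟩⟩
    · refine ((IsChain.singleton).insert ?_).insert ?_
      · exact fun _ _ _ => Or.inr le_top
      · exact fun _ _ _ => Or.inl bot_le
    · intro i hi
      obtain rfl : i = 0 := by omega
      exact hφ (W 0) (by simp)
  | succ k ih =>
    obtain ⟨C, hC, hb, ht, hW, h⟩ := ih
    refine ⟨_, isChain_relImage hC (L k) (W (k + 1)) (hL k), by simp, by simp, by simp, ?_⟩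
    intro φ hφ
    obtain ⟨ψ, hψC, hψL⟩ := exists_lift_preserving_chain hC hb ht (L k) φ
      (fun F hF => hφ _ (Or.inr (Or.inr (Or.inr ⟨F, hF, rfl⟩))))
    obtain ⟨Φ, hΦk, hΦW, hΦL⟩ := h ψ hψC
    refine ⟨Function.update Φ (k + 1) φ, by simp, ?_, ?_⟩
    · intro i hi
      obtain rfl | hi := hi.eq_or_lt
      · simpa using hφ (W (k + 1)) (by simp)
      · rw [Function.update_of_ne hi.ne]
        exact hΦW i (by omega)
    · intro i hi p hp
      rw [Function.update_of_ne hi.ne]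
      obtain rfl | hi' := (Nat.lt_succ_iff.mp hi).eq_or_lt
      · rw [Function.update_self, hΦk]
        exact hψL p hp
      · rw [Function.update_of_ne (by omega)]
        exact hΦL i hi' p hp

/-- Every subspace `W k` of a zigzag of linear relations carries a chain such that the
endomorphisms preserving it extend to the part of the zigzag right of `k`. -/
theorem exists_chain_right (W : ℕ → Submodule K M) (L : ℕ → Submodule K (M × M))
    (hL : ∀ i, ∀ p ∈ L i, p.1 ∈ W i) (j k : ℕ) :
    ∃ C : Set (Submodule K M), IsChain (· ≤ ·) C ∧ ⊥ ∈ C ∧ ⊤ ∈ C ∧ W k ∈ C ∧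
      ∀ φ : M →ₗ[K] M, (∀ F ∈ C, ∀ x ∈ F, φ x ∈ F) → ∃ Φ : ℕ → M →ₗ[K] M, Φ k = φ ∧
        (∀ i, k ≤ i → i ≤ k + j → ∀ x ∈ W i, Φ i x ∈ W i) ∧
        ∀ i, k ≤ i → i < k + j → ∀ p ∈ L i, (Φ i p.1, Φ (i + 1) p.2) ∈ L i := by
  induction j generalizing k with
  | zero =>
    refine ⟨{⊥, ⊤, W k}, ?_, by simp, by simp, by simp, fun φ hφ => ⟨fun _ => φ, rfl, ?_, ?_⟩⟩
    · refine ((IsChain.singleton).insert ?_).insert ?_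
      · exact fun _ _ _ => Or.inr le_top
      · exact fun _ _ _ => Or.inl bot_le
    · intro i hi hi'
      obtain rfl : i = k := by omega
      exact hφ (W i) (by simp)
    · intro i hi hi'
      omega
  | succ j ih =>
    obtain ⟨C, hC, hb, ht, hW, h⟩ := ih (k + 1)
    -- The relation read backwards, which turns the extension to the right into the same lifting
    -- problem.
    let L' : Submodule K (M × M) := (L k).comap (LinearEquiv.prodComm K M M).toLinearMap
    refine ⟨_, isChain_relImage hC L' (W k) (fun p hp => hL k _ hp), by simp, by simp,
      by simp, ?_⟩
    intro φ hφ
    obtain ⟨ψ, hψC, hψL⟩ := exists_lift_preserving_chain hC hb ht L' φ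
      (fun F hF => hφ _ (Or.inr (Or.inr (Or.inr ⟨F, hF, rfl⟩))))
    obtain ⟨Φ, hΦk, hΦW, hΦL⟩ := h ψ hψC
    refine ⟨Function.update Φ k φ, by simp, ?_, ?_⟩
    · intro i hi hi'
      obtain rfl | hi := hi.eq_or_lt
      · simpa using hφ (W k) (by simp)
      · rw [Function.update_of_ne hi.ne']
        exact hΦW i (by omega) (by omega)
    · intro i hi hi' p hp
      rw [Function.update_of_ne (show i + 1 ≠ k by omega)]
      obtain rfl | hi := hi.eq_or_lt
      · rw [Function.update_self, hΦk]
        exact hψL (p.2, p.1) hp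
      · rw [Function.update_of_ne hi.ne']
        exact hΦL i (by omega) (by omega) p hp

/-- Two chains of subspaces have a common invariant rank one projection onto a line inside a given
nonzero member `W` of the first chain. -/
theorem exists_projection_preserving_chains {C D : Set (Submodule K M)}
    (hC : IsChain (· ≤ ·) C) (hD : IsChain (· ≤ ·) D) (hDtop : ⊤ ∈ D)
    {W : Submodule K M} (hW : W ∈ C) (hW0 : W ≠ ⊥) :
    ∃ (x : M) (ξ : M →ₗ[K] K), x ∈ W ∧ ξ x = 1 ∧ (∀ F ∈ C, ∀ y ∈ F, ξ y • x ∈ F) ∧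
      ∀ F ∈ D, ∀ y ∈ F, ξ y • x ∈ F := by
  -- With `F` the least nonzero member of `C` and `G` the least member of `D` meeting `F`, take `x ∈
  -- F ⊓ G`. Nonzero members of `C` contain `x`. Members of `D` either contain `G`, hence `x`, or
  -- lie in the largest member `B` not containing `G`; that one meets `F` trivially, so some `ξ`
  -- kills `B` but not `x`.
  obtain ⟨F, ⟨hFC, hF⟩, hFmin⟩ := WellFounded.has_min (wellFounded_lt (α := Submodule K M))
    {F | F ∈ C ∧ F ≠ ⊥} ⟨W, hW, hW0⟩
  obtain ⟨G, ⟨hGD, hG⟩, hGmin⟩ := WellFounded.has_min (wellFounded_lt (α := Submodule K M))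
    {G | G ∈ D ∧ F ⊓ G ≠ ⊥} ⟨⊤, hDtop, by simpa using hF⟩
  have hFle : ∀ F' ∈ C, F' ≠ ⊥ → F ≤ F' := by
    intro F' hF' h
    refine (hC.total hFC hF').elim id fun h' => ?_
    obtain rfl | h' := h'.eq_or_lt
    · exact le_rfl
    · exact absurd h' (hFmin F' ⟨hF', h⟩)
  have hGle : ∀ G' ∈ D, ¬ G ≤ G' → F ⊓ G' = ⊥ := by
    intro G' hG' h
    by_contra h'
    exact hGmin G' ⟨hG', h'⟩ (lt_of_le_not_ge ((hD.total hG' hGD).resolve_right h) h)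
  obtain ⟨x, ⟨hxF, hxG⟩, hx0⟩ := (Submodule.ne_bot_iff _).mp hG
  have hS : ∃ B : Submodule K M, x ∉ B ∧ ∀ G' ∈ D, ¬ G ≤ G' → G' ≤ B := by
    by_cases hne : {G' | G' ∈ D ∧ ¬ G ≤ G'}.Nonempty
    · obtain ⟨B, ⟨hBD, hB⟩, hmax⟩ := WellFounded.has_min (wellFounded_gt (α := Submodule K M)) _ hne
      refine ⟨B, fun hxB => hx0 ?_, fun G' hG' h => ?_⟩
      · have : x ∈ F ⊓ B := ⟨hxF, hxB⟩
        rwa [hGle B hBD hB, Submodule.mem_bot] at this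
      · refine (hD.total hG' hBD).elim id fun h' => ?_
        obtain rfl | h' := h'.eq_or_lt
        · exact le_rfl
        · exact absurd h' (hmax G' ⟨hG', h⟩)
    · refine ⟨⊥, hx0, fun G' hG' h => absurd ⟨G', hG', h⟩ hne⟩
  obtain ⟨B, hxB, hB⟩ := hS
  obtain ⟨ξ, hξx, hξB⟩ := Submodule.exists_le_ker_of_notMem hxB
  refine ⟨x, (ξ x)⁻¹ • ξ, hFle W hW hW0 hxF, by simp [hξx], ?_, ?_⟩
  · intro F' hF' y hy
    by_cases h : F' = ⊥
    · subst h
      rw [Submodule.mem_bot] at hy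
      simp [hy]
    · exact F'.smul_mem _ (hFle F' hF' h hxF)
  · intro G' hG' y hy
    by_cases h : G ≤ G'
    · exact G'.smul_mem _ (h hxG)
    · have : ξ y = 0 := hξB (hB G' hG' h hy)
      simp [this]

/-- A zigzag of linear relations with a subspace `W k` of dimension at least two has an
endomorphism that fixes a nonzero vector of `W k` and annihilates another one. -/
theorem exists_zigzag_endomorphism (W : ℕ → Submodule K M) (L : ℕ → Submodule K (M × M))
    (hL₁ : ∀ i, ∀ p ∈ L i, p.1 ∈ W i) (hL₂ : ∀ i, ∀ p ∈ L i, p.2 ∈ W (i + 1)) {k N : ℕ}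
    (hk : k ≤ N) (hW : 1 < Module.finrank K (W k)) :
    ∃ Φ : ℕ → M →ₗ[K] M, (∀ i ≤ N, ∀ x ∈ W i, Φ i x ∈ W i) ∧
      (∀ i < N, ∀ p ∈ L i, (Φ i p.1, Φ (i + 1) p.2) ∈ L i) ∧
      (∃ x ∈ W k, x ≠ 0 ∧ Φ k x = x) ∧ ∃ x ∈ W k, x ≠ 0 ∧ Φ k x = 0 := by
  obtain ⟨C, hC, -, -, hWC, hleft⟩ := exists_chain_left W L hL₂ k
  obtain ⟨D, hD, -, hDt, -, hright⟩ := exists_chain_right W L hL₁ (N - k) k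
  have hW0 : W k ≠ ⊥ := by
    intro h
    rw [h, finrank_bot] at hW
    omega
  obtain ⟨x, ξ, hxW, hξx, hξC, hξD⟩ := exists_projection_preserving_chains hC hD hDt hWC hW0
  obtain ⟨Φ, hΦk, hΦW, hΦL⟩ := hleft (ξ.smulRight x) (by simpa using hξC)
  obtain ⟨Ψ, hΨk, hΨW, hΨL⟩ := hright (ξ.smulRight x) (by simpa using hξD)
  -- The two extensions agree at `k`, where both are the rank one projection. Its kernel meets `W k`
  -- because `W k` has dimension at least two.
  refine ⟨fun i => if i ≤ k then Φ i else Ψ i, ?_, ?_, ⟨x, hxW, ?_, ?_⟩, ?_⟩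
  · intro i hi
    by_cases h : i ≤ k
    · simpa [h] using hΦW i h
    · simpa [h] using hΨW i (by omega) (by omega)
  · intro i hi p hp
    by_cases h : i + 1 ≤ k
    · have := hΦL i (by omega) p hp
      simpa [h, show i ≤ k by omega] using this
    · have := hΨL i (by omega) (by omega) p hp
      by_cases h' : i = k
      · subst h'
        simpa [hΦk, hΨk] using this
      · simpa [h, show ¬ i ≤ k by omega] using this
  · rintro rfl
    simp at hξx
  · simp [hΦk, hξx]
  · have hker : (LinearMap.ker (ξ.domRestrict (W k))) ≠ ⊥ := by
      intro h
      have := LinearMap.finrank_le_finrank_of_injective (LinearMap.ker_eq_bot.mp h)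
      rw [Module.finrank_self] at this
      omega
    obtain ⟨⟨z, hz⟩, hzk, hz0⟩ := (Submodule.ne_bot_iff _).mp hker
    refine ⟨z, hz, fun h => hz0 (by simpa using h), ?_⟩
    have : ξ z = 0 := hzk
    simp [hΦk, this]

end FlagExtension

/-! ### Uniserial modules and total orders of submodules. -/

section Uniserial

variable {S M : Type*} [Ring S] [AddCommGroup M] [Module S M]

/-- Consecutive terms of the series cover one another, so a submodule comparable with all of them
has no room strictly between two terms. -/
theorem CompositionSeries.mem_of_total {s : CompositionSeries (Submodule S M)}
    (hs : s.head = ⊥) (hs' : s.last = ⊤) (N : Submodule S M)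
    (h : ∀ A : Submodule S M, A ≤ N ∨ N ≤ A) : N ∈ s := by
  suffices ∀ i, N ≤ s i → N ∈ s from
    this (Fin.last _) (by change N ≤ s.last; rw [hs']; exact le_top)
  intro i
  induction i using Fin.induction with
  | zero =>
    intro hN
    change N ≤ s.head at hN
    rw [hs, le_bot_iff] at hN
    exact ⟨0, by rw [hN]; exact hs⟩
  | succ i ih =>
    intro hN
    rcases h (s i.castSucc) with h | h
    · have hcov : s i.castSucc ⋖ s i.succ := s.step i
      rcases hcov.eq_or_eq h hN with h | h
      · exact ⟨_, h.symm⟩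
      · exact ⟨_, h.symm⟩
    · exact ih h

/-- A module of finite length whose submodules are totally ordered is uniserial. -/
theorem isUniserialModule_of_total [IsNoetherian S M] [IsArtinian S M]
    (h : ∀ A B : Submodule S M, A ≤ B ∨ B ≤ A) : IsUniserialModule S M := by
  obtain ⟨s, hs, hs'⟩ := exists_compositionSeries_of_isNoetherian_isArtinian S M
  refine ⟨s, ⟨hs, hs'⟩, fun t ⟨ht, ht'⟩ => CompositionSeries.ext fun N => ?_⟩
  exact ⟨fun _ => CompositionSeries.mem_of_total hs hs' N (h · N),
    fun _ => CompositionSeries.mem_of_total ht ht' N (h · N)⟩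

/-- The submodules of a uniserial module are totally ordered. -/
theorem IsUniserialModule.total (h : IsUniserialModule S M) (A B : Submodule S M) :
    A ≤ B ∨ B ≤ A := by
  obtain ⟨s, hs, huniq⟩ := h
  have hfin := isFiniteLength_of_exists_compositionSeries ⟨s, hs⟩
  obtain ⟨_, _⟩ := isFiniteLength_iff_isNoetherian_isArtinian.mp hfin
  have key : ∀ N : Submodule S M, N ∈ s := by
    intro N
    -- `N` alone is a chain, and refines to a composition series through `N`; uniqueness makes this
    -- series `s`.
    obtain ⟨t, i, hti, ht⟩ :=
      LTSeries.exists_relSeries_covBy_and_head_eq_bot_and_last_eq_bot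
        (⟨0, fun _ => N, nofun⟩ : LTSeries (Submodule S M))
    have hts : t = s := huniq t ht
    rw [← hts]
    exact ⟨i 0, congrFun hti 0⟩
  exact CompositionSeries.total (key A) (key B)

theorem IsUniserialModule.total_of_quotient {N : Submodule S M}
    (h : IsUniserialModule S (M ⧸ N)) {A B : Submodule S M} (hA : N ≤ A) (hB : N ≤ B) :
    A ≤ B ∨ B ≤ A := by
  have hcomap : ∀ C, N ≤ C → (C.map N.mkQ).comap N.mkQ = C := fun C hC => by
    rw [Submodule.comap_map_mkQ, sup_eq_right.mpr hC]
  rw [← hcomap A hA, ← hcomap B hB]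
  exact (h.total (A.map N.mkQ) (B.map N.mkQ)).imp (Submodule.comap_mono ·)
    (Submodule.comap_mono ·)

theorem isUniserialModule_quotient_of_total [IsNoetherian S M] [IsArtinian S M]
    {N : Submodule S M} (h : ∀ A B : Submodule S M, N ≤ A → N ≤ B → A ≤ B ∨ B ≤ A) :
    IsUniserialModule S (M ⧸ N) := by
  refine isUniserialModule_of_total fun A B => ?_
  have hle : ∀ C : Submodule S (M ⧸ N), N ≤ C.comap N.mkQ := fun C => Submodule.le_comap_mkQ N C
  exact (h _ _ (hle A) (hle B)).imp
    (Submodule.comap_le_comap_iff_of_surjective N.mkQ_surjective).mp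
    (Submodule.comap_le_comap_iff_of_surjective N.mkQ_surjective).mp

end Uniserial

/-! ### Radical series, factor seriality and Fitting's lemma. -/

section RadicalSeries

variable {S M : Type*} [Ring S] [AddCommGroup M] [Module S M]

theorem map_jacobson_subtype_mono {N N' : Submodule S M} (h : N ≤ N') :
    (Module.jacobson S N).map N.subtype ≤ (Module.jacobson S N').map N'.subtype := by
  have h₁ := Submodule.map_mono (f := N'.subtype)
    (Module.map_jacobson_le (Submodule.inclusion h))
  rwa [← Submodule.map_comp, Submodule.subtype_comp_inclusion] at h₁

theorem map_jacobson_subtype_le_of_covBy {N N' : Submodule S M} (h : N' ⋖ N) :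
    (Module.jacobson S N).map N.subtype ≤ N' := by
  have hco : IsCoatom (N'.comap N.subtype) := by
    have := (covBy_iff_quot_is_simple h.le).mp h
    exact isSimpleModule_iff_isCoatom.mp this
  rw [Submodule.map_le_iff_le_comap]
  exact sInf_le hco

theorem map_jacobson_subtype_lt [IsNoetherian S M] {N : Submodule S M} (h : N ≠ ⊥) :
    (Module.jacobson S N).map N.subtype < N := by
  have : Nontrivial N := Submodule.nontrivial_iff_ne_bot.mpr h
  have hlt := Submodule.map_strictMono_of_injective N.injective_subtype
    (Module.jacobson_lt_top S N)
  simpa using hlt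

/-- Radical powers are bounded from above without being computed: each step down a chain of covers
from `⊤` absorbs one more radical. -/
theorem radPow_succ_le_of_covBy {N N' : Submodule S M} {i : ℕ} (hN : radPow S M i ≤ N)
    (h : N' ⋖ N) : radPow S M (i + 1) ≤ N' :=
  (map_jacobson_subtype_mono hN).trans (map_jacobson_subtype_le_of_covBy h)

theorem radPow_succ_le (i : ℕ) : radPow S M (i + 1) ≤ radPow S M i :=
  Submodule.map_subtype_le _ _

theorem radPow_antitone : Antitone (radPow S M) :=
  antitone_nat_of_succ_le radPow_succ_le

theorem radPow_succ_lt [IsNoetherian S M] {i : ℕ} (h : radPow S M i ≠ ⊥) :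
    radPow S M (i + 1) < radPow S M i :=
  map_jacobson_subtype_lt h

/-- If the Loewy length of a module is equal to its length then its submodules are totally
ordered. -/
theorem total_of_radPow_ne_bot [IsNoetherian S M] [IsArtinian S M] {l : ℕ}
    (hl : Module.length S M = (l + 1 : ℕ)) (h : radPow S M l ≠ ⊥) (A B : Submodule S M) :
    A ≤ B ∨ B ≤ A := by
  have hne : ∀ i ≤ l, radPow S M i ≠ ⊥ := fun i hi h' =>
    h (le_bot_iff.mp (h' ▸ radPow_antitone hi))
  -- The radical series drops strictly until it vanishes. Counting drops from the top and from the
  -- bottom pins the height of the `i`-th power at `l + 1 - i`, so successive powers cover one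
  -- another.
  have hupper : ∀ i ≤ l + 1, Order.height (radPow S M i) + i ≤ (l + 1 : ℕ) := by
    intro i hi
    induction i with
    | zero =>
      rw [← hl, Module.length_eq_height]
      simp [radPow]
    | succ i ih =>
      refine le_trans ?_ (ih (by omega))
      have := Order.height_add_one_le (radPow_succ_lt (hne i (by omega)))
      push_cast
      rw [add_comm (i : ℕ∞) 1, ← add_assoc]
      gcongr
  have hlower : ∀ j ≤ l, (j + 1 : ℕ) ≤ Order.height (radPow S M (l - j)) := by
    intro j hj
    induction j with
    | zero =>
      have := Order.height_pos_of_bot_lt (bot_lt_iff_ne_bot.mpr h)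
      simpa using Order.one_le_iff_pos.mpr this
    | succ j ih =>
      have h₁ := ih (by omega)
      have h₂ := radPow_succ_lt (hne (l - (j + 1)) (by omega))
      rw [show l - (j + 1) + 1 = l - j by omega] at h₂
      refine le_trans ?_ (Order.height_add_one_le h₂)
      push_cast at h₁ ⊢
      gcongr
  have hend : radPow S M (l + 1) = ⊥ := by
    have h₁ := hupper (l + 1) le_rfl
    have h₂ : Order.height (radPow S M (l + 1)) = 0 := by
      have hfin := (radPow S M (l + 1)).height_lt_top
      obtain ⟨m, hm⟩ := ENat.ne_top_iff_exists.mp hfin.ne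
      rw [← hm] at h₁ ⊢
      norm_cast at h₁ ⊢
      omega
    rw [Order.height_eq_zero] at h₂
    exact h₂.eq_bot
  have hcov : ∀ i ≤ l, ∀ X, radPow S M (i + 1) ≤ X → X < radPow S M i →
      X = radPow S M (i + 1) := by
    intro i hi X h₁ h₂
    by_contra hX
    have h₃ := lt_of_le_of_ne h₁ (Ne.symm hX)
    have h₄ : ((l - i : ℕ) : ℕ∞) ≤ Order.height (radPow S M (i + 1)) := by
      obtain rfl | hi' := hi.eq_or_lt
      · simp
      · have := hlower (l - (i + 1)) (by omega)
        rwa [show l - (l - (i + 1)) = i + 1 by omega,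
          show l - (i + 1) + 1 = l - i by omega] at this
    have h₅ := Order.height_add_one_le h₃
    have h₆ := Order.height_add_one_le h₂
    have h₇ := hupper i (by omega)
    have h₈ : ((l - i : ℕ) : ℕ∞) + 1 + 1 + i ≤ (l + 1 : ℕ) := by
      refine le_trans ?_ h₇
      gcongr
      refine le_trans ?_ h₆
      gcongr
      refine le_trans ?_ h₅
      gcongr
    norm_cast at h₈
    omega
  -- Take the last power containing `N`. If `N` were proper in it, `N` would lie in a maximal
  -- submodule of that power, which by `hcov` is the next power.
  have hall : ∀ N : Submodule S M, ∃ i, N = radPow S M i := by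
    intro N
    by_cases hN : N ≤ radPow S M (l + 1)
    · exact ⟨l + 1, le_antisymm hN (hend ▸ bot_le)⟩
    classical
    have hex : ∃ i, ¬ N ≤ radPow S M i := ⟨_, hN⟩
    have hpos : Nat.find hex ≠ 0 := fun h0 => by
      have := Nat.find_spec hex
      rw [h0] at this
      exact this le_top
    obtain ⟨i, hi⟩ := Nat.exists_eq_succ_of_ne_zero hpos
    have h₁ : ¬ N ≤ radPow S M (i + 1) := by
      have := Nat.find_spec hex
      rwa [hi] at this
    have h₂ : N ≤ radPow S M i := by
      by_contra h'
      have := Nat.find_min' hex h'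
      omega
    have hil : i ≤ l := by
      have := Nat.find_min' hex hN
      omega
    refine ⟨i, ?_⟩
    by_contra hne'
    have hlt := lt_of_le_of_ne h₂ hne'
    obtain ⟨X, hX, hXcov⟩ := exists_le_covBy_of_lt hlt
    have := hcov i hil X (radPow_succ_le_of_covBy le_rfl hXcov) hXcov.lt
    exact h₁ (this ▸ hX)
  obtain ⟨i, rfl⟩ := hall A
  obtain ⟨j, rfl⟩ := hall B
  exact (le_total j i).imp (radPow_antitone ·) (radPow_antitone ·)

/-- A module of finite length `l` is uniserial or `m`-factor serial for some `1 < m ≤ l`. -/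
theorem isUniserialModule_or_exists_isFactorSerial [IsNoetherian S M] [IsArtinian S M] {l : ℕ}
    (hl : Module.length S M = l) :
    IsUniserialModule S M ∨ ∃ m, 1 < m ∧ m ≤ l ∧ IsFactorSerial S M m := by
  by_cases huni : IsUniserialModule S M
  · exact Or.inl huni
  refine Or.inr ?_
  obtain _ | l := l
  · have := Module.length_eq_zero_iff.mp hl
    exact absurd (isUniserialModule_of_total fun A B => Or.inl (Subsingleton.elim A B).le) huni
  -- The length is now `l + 1`. Either the `l`-th power is zero and this quotient is `M`, or the
  -- Loewy length equals the length.
  have hnot : ¬ IsUniserialModule S (M ⧸ radPow S M l) := by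
    intro h
    refine huni (isUniserialModule_of_total ?_)
    by_cases hbot : radPow S M l = ⊥
    · rw [hbot] at h
      exact fun A B => h.total_of_quotient bot_le bot_le
    · exact total_of_radPow_ne_bot hl hbot
  classical
  have hex : ∃ i, ¬ IsUniserialModule S (M ⧸ radPow S M i) := ⟨l, hnot⟩
  have hzero : IsUniserialModule S (M ⧸ radPow S M 0) :=
    isUniserialModule_quotient_of_total fun A B hA hB => Or.inl (le_top.trans hB)
  have hpos : Nat.find hex ≠ 0 := fun h0 => by
    have := Nat.find_spec hex
    rw [h0] at this
    exact this hzero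
  obtain ⟨i, hi⟩ := Nat.exists_eq_succ_of_ne_zero hpos
  have h₁ : ¬ IsUniserialModule S (M ⧸ radPow S M (i + 1)) := by
    have := Nat.find_spec hex
    rwa [hi] at this
  have h₂ : IsUniserialModule S (M ⧸ radPow S M i) := by
    by_contra h'
    have := Nat.find_min' hex h'
    omega
  have hil : i + 1 ≤ l := by
    have := Nat.find_min' hex hnot
    omega
  -- `i + 1` is the first exponent with a non-uniserial quotient; exponent `0` gives the zero
  -- quotient, which is uniserial.
  refine ⟨l + 1 - i, by omega, by omega, Or.inr ⟨by omega, l + 1, hl, by omega, ?_, ?_⟩⟩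
  · rwa [show l + 1 - (l + 1 - i) = i by omega]
  · rwa [show l + 1 - (l + 1 - i) = i by omega]

/-- If `M` is indecomposable of finite length, an endomorphism of `M` that fixes a nonzero element
is injective. -/
theorem IsIndecomposableModule.ker_eq_bot_of_fixed [IsNoetherian S M] [IsArtinian S M]
    (hM : IsIndecomposableModule S M) (f : M →ₗ[S] M) {x : M} (hx : x ≠ 0) (hfx : f x = x) :
    ∀ y, f y = 0 → y = 0 := by
  obtain ⟨n, hn⟩ := Filter.eventually_atTop.mp
    (LinearMap.eventually_isCompl_ker_pow_range_pow (R := S) f)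
  -- Fitting decomposition. The exponent is positive so that `ker f` lies in the kernel of the
  -- power; the fixed vector keeps the range nonzero.
  have hc := hn (n + 1) (by omega)
  have hpow : ∀ m, (f ^ m) x = x := by
    intro m
    induction m with
    | zero => simp
    | succ m ih => rw [pow_succ, Module.End.mul_apply, hfx, ih]
  rcases hM.2 _ _ hc with h | h
  · intro y hy
    have : y ∈ LinearMap.ker (f ^ (n + 1)) := by
      rw [LinearMap.mem_ker, pow_succ, Module.End.mul_apply, hy, map_zero]
    rwa [h, Submodule.mem_bot] at this
  · have : x ∈ LinearMap.range (f ^ (n + 1)) := ⟨x, hpow _⟩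
    rw [h, Submodule.mem_bot] at this
    exact absurd this hx

end RadicalSeries

/-! ### The basis of paths. -/

namespace PathAlgebra

variable {K : Type u} [CommRing K] {V : Type v} [Quiver.{w} V]

open Classical in
/-- The basis element of the path algebra given by a path. -/
noncomputable def ofPath (K : Type u) [CommRing K] {a b : V} (p : Path a b) : PathAlgebra K V :=
  Pi.single a (Pi.single b (Finsupp.single p 1))

theorem ofPath_apply_self {a b : V} (p : Path a b) :
    ofPath K p a b = Finsupp.single p 1 := by
  simp [ofPath]

theorem ofPath_apply_source_ne {a b : V} (p : Path a b) {a' : V} (h : a' ≠ a) (b' : V) :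
    ofPath K p a' b' = 0 := by
  simp [ofPath, h]

theorem ofPath_apply_target_ne {a b : V} (p : Path a b) (a' : V) {b' : V} (h : b' ≠ b) :
    ofPath K p a' b' = 0 := by
  by_cases ha : a' = a
  · subst ha
    simp [ofPath, h]
  · exact ofPath_apply_source_ne p ha b'

variable [Fintype V]

theorem ofPath_mul_ofPath {a b c : V} (p : Path a b) (q : Path b c) :
    ofPath K p * ofPath K q = ofPath K (p.comp q) := by
  funext x y
  rw [mul_apply]
  by_cases hx : x = a
  · subst hx
    by_cases hy : y = c
    · subst hy
      rw [Finset.sum_eq_single b, ofPath_apply_self, ofPath_apply_self, ofPath_apply_self,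
        pathConcat_single, one_mul]
      · intro z _ hz
        rw [ofPath_apply_target_ne p _ hz, map_zero, LinearMap.zero_apply]
      · simp
    · rw [ofPath_apply_target_ne _ _ hy]
      exact Finset.sum_eq_zero fun z _ => by rw [ofPath_apply_target_ne q _ hy, map_zero]
  · rw [ofPath_apply_source_ne _ hx]
    exact Finset.sum_eq_zero fun z _ => by
      rw [ofPath_apply_source_ne p hx, map_zero, LinearMap.zero_apply]

theorem ofPath_mul_ofPath_of_ne {a b b' c : V} (p : Path a b) (q : Path b' c) (h : b ≠ b') :
    ofPath K p * ofPath K q = 0 := by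
  funext x y
  rw [mul_apply]
  refine Finset.sum_eq_zero fun z _ => ?_
  by_cases hz : z = b
  · subst hz
    rw [ofPath_apply_source_ne q h, map_zero]
  · rw [ofPath_apply_target_ne p _ hz, map_zero, LinearMap.zero_apply]

theorem sum_ofPath_nil : ∑ a : V, ofPath K (Path.nil : Path a a) = 1 := by
  funext x y
  have happly : ∀ s : Finset V, (∑ a ∈ s, ofPath K (Path.nil : Path a a)) x y =
      ∑ a ∈ s, ofPath K (Path.nil : Path a a) x y := by
    classical
    intro s
    induction s using Finset.induction_on with
    | empty => simp [zero_apply]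
    | insert a s ha ih => rw [Finset.sum_insert ha, Finset.sum_insert ha, add_apply, ih]
  rw [happly, Finset.sum_eq_single x]
  · by_cases h : x = y
    · subst h
      rw [ofPath_apply_self, one_apply_self]
    · rw [ofPath_apply_target_ne _ _ (Ne.symm h), one_apply_ne h]
  · exact fun z _ hz => ofPath_apply_source_ne _ hz.symm _
  · simp

/-- The paths span the path algebra. -/
theorem span_range_ofPath :
    Submodule.span K (Set.range fun p : Σ a b : V, Path a b => ofPath K p.2.2) = ⊤ := by
  classical
  rw [eq_top_iff]
  rintro f -
  have key : ∀ a b, (Pi.single a (Pi.single b (f a b)) : PathAlgebra K V) ∈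
      Submodule.span K (Set.range fun p : Σ a b : V, Path a b => ofPath K p.2.2) := by
    intro a b
    induction f a b using Finsupp.induction_linear with
    | zero =>
      rw [Pi.single_zero, Pi.single_zero]
      exact Submodule.zero_mem _
    | add g h hg hh =>
      rw [Pi.single_add, Pi.single_add]
      exact Submodule.add_mem _ hg hh
    | single p x =>
      have : (Pi.single a (Pi.single b (Finsupp.single p x)) : PathAlgebra K V) =
          x • ofPath K p := by
        funext a' b'
        rw [smul_apply]
        by_cases ha : a' = a
        · subst ha
          by_cases hb : b' = b
          · subst hb
            simp [ofPath_apply_self]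
          · rw [ofPath_apply_target_ne _ _ hb]
            simp [hb]
        · rw [ofPath_apply_source_ne _ ha]
          simp [ha]
      exact this ▸ Submodule.smul_mem (R := K) (M := PathAlgebra K V) _ x
        (Submodule.subset_span ⟨⟨a, b, p⟩, rfl⟩)
  have hf : f = ∑ a, ∑ b, (Pi.single a (Pi.single b (f a b)) : PathAlgebra K V) := by
    have h₁ : ∀ a, ∑ b, (Pi.single a (Pi.single b (f a b)) : PathAlgebra K V) =
        Pi.single a (f a) := by
      intro a
      conv_rhs => rw [← Finset.univ_sum_single (f a)]
      exact (map_sum (AddMonoidHom.single (fun a : V => ∀ b, Path a b →₀ K) a) _ _).symm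
    simp_rw [h₁]
    exact (Finset.univ_sum_single f).symm
  rw [hf]
  exact Submodule.sum_mem _ fun a _ => Submodule.sum_mem _ fun b _ => key a b

theorem module_finite [∀ a b : V, Finite (Path a b)] : Module.Finite K (PathAlgebra K V) :=
  ⟨Submodule.fg_def.mpr ⟨_, Set.finite_range _, span_range_ofPath⟩⟩

end PathAlgebra

/-! ### Modules over the path algebra as quiver representations. -/

section Representation

open PathAlgebra

variable (K : Type u) [CommRing K] {V : Type v} [Quiver.{w} V] [Fintype V]
  (M : Type*) [AddCommGroup M] [Module K M] [Module (PathAlgebra K V)ᵐᵒᵖ M]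
  [IsScalarTower K (PathAlgebra K V)ᵐᵒᵖ M]

/-- The right action of a path on a module over the path algebra. -/
noncomputable def pathAct {a b : V} (p : Path a b) : M →ₗ[K] M :=
  Algebra.lsmul K K M (MulOpposite.op (ofPath K p))

variable {M}

theorem pathAct_apply {a b : V} (p : Path a b) (m : M) :
    pathAct K M p m = MulOpposite.op (ofPath K p) • m := rfl

theorem pathAct_pathAct {a b c : V} (p : Path a b) (q : Path b c) (m : M) :
    pathAct K M q (pathAct K M p m) = pathAct K M (p.comp q) m := by
  simp only [pathAct_apply, smul_smul, ← MulOpposite.op_mul, ofPath_mul_ofPath]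

theorem pathAct_pathAct_of_ne {a b b' c : V} (p : Path a b) (q : Path b' c) (h : b ≠ b') (m : M) :
    pathAct K M q (pathAct K M p m) = 0 := by
  simp only [pathAct_apply, smul_smul, ← MulOpposite.op_mul, ofPath_mul_ofPath_of_ne p q h,
    MulOpposite.op_zero, zero_smul]

variable (M) in
/-- The projection of a module over the path algebra onto its component at a vertex. -/
noncomputable abbrev vertexProj (a : V) : M →ₗ[K] M := pathAct K M (Path.nil : Path a a)

theorem vertexProj_vertexProj (a : V) (m : M) :
    vertexProj K M a (vertexProj K M a m) = vertexProj K M a m := by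
  rw [pathAct_pathAct, Path.comp_nil]

theorem vertexProj_vertexProj_of_ne {a b : V} (h : a ≠ b) (m : M) :
    vertexProj K M b (vertexProj K M a m) = 0 :=
  pathAct_pathAct_of_ne K _ _ h m

theorem pathAct_vertexProj {a b : V} (p : Path a b) (m : M) :
    pathAct K M p (vertexProj K M a m) = pathAct K M p m := by
  rw [pathAct_pathAct, Path.nil_comp]

theorem vertexProj_pathAct {a b : V} (p : Path a b) (m : M) :
    vertexProj K M b (pathAct K M p m) = pathAct K M p m := by
  rw [pathAct_pathAct, Path.comp_nil]

theorem sum_vertexProj (m : M) : ∑ a : V, vertexProj K M a m = m := by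
  simp only [pathAct_apply, ← Finset.sum_smul]
  rw [← Finset.op_sum, sum_ofPath_nil, MulOpposite.op_one, one_smul]

variable (M) in
/-- The component of a module over the path algebra at a vertex. -/
noncomputable def vertexSpace (a : V) : Submodule K M := LinearMap.range (vertexProj K M a)

theorem mem_vertexSpace {a : V} {m : M} : m ∈ vertexSpace K M a ↔ vertexProj K M a m = m := by
  constructor
  · rintro ⟨x, rfl⟩
    exact vertexProj_vertexProj K a x
  · exact fun h => ⟨m, h⟩

theorem pathAct_mem_vertexSpace {a b : V} (p : Path a b) (m : M) :
    pathAct K M p m ∈ vertexSpace K M b :=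
  (mem_vertexSpace K).mpr (vertexProj_pathAct K p m)

theorem vertexProj_of_mem_of_ne {a b : V} (h : a ≠ b) {m : M} (hm : m ∈ vertexSpace K M a) :
    vertexProj K M b m = 0 := by
  rw [← (mem_vertexSpace K).mp hm]
  exact vertexProj_vertexProj_of_ne K h m

/-- To check a `K`-linear condition on the action of the path algebra it suffices to consider
vertices and arrows. -/
theorem smul_induction {P : (PathAlgebra K V)ᵐᵒᵖ → Prop} (hnil : ∀ a : V, P (.op (ofPath K
      (Path.nil : Path a a))))
    (harrow : ∀ (a b : V) (α : a ⟶ b), P (.op (ofPath K α.toPath)))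
    (hzero : P 0) (hadd : ∀ f g, P f → P g → P (f + g)) (hsmul : ∀ (c : K) f, P f → P (c • f))
    (hmul : ∀ f g, P f → P g → P (f * g)) (f : (PathAlgebra K V)ᵐᵒᵖ) : P f := by
  obtain ⟨f, rfl⟩ := MulOpposite.op_surjective f
  have hf : f ∈ Submodule.span K (Set.range fun p : Σ a b : V, Path a b => ofPath K p.2.2) := by
    rw [span_range_ofPath]
    trivial
  induction hf using Submodule.span_induction with
  | zero => exact hzero
  | add x y _ _ hx hy => exact hadd _ _ hx hy
  | smul c x _ hx => exact hsmul c _ hx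
  | mem x hx =>
    obtain ⟨⟨a, b, p⟩, rfl⟩ := hx
    simp only
    induction p with
    | nil => exact hnil a
    | cons p α ih =>
      -- The last arrow is the left factor, since multiplication in the opposite algebra is
      -- reversed.
      have := hmul _ _ (harrow _ _ α) ih
      rwa [← MulOpposite.op_mul, ofPath_mul_ofPath] at this

/-- A `K`-linear endomorphism commuting with the vertex projections and the arrows is linear over
the path algebra. -/
noncomputable def endOfCommute (φ : M →ₗ[K] M)
    (hv : ∀ (a : V) (m : M), φ (vertexProj K M a m) = vertexProj K M a (φ m))
    (ha : ∀ (a b : V) (α : a ⟶ b) (m : M),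
      φ (pathAct K M α.toPath m) = pathAct K M α.toPath (φ m)) :
    M →ₗ[(PathAlgebra K V)ᵐᵒᵖ] M where
  __ := φ
  map_smul' f m := by
    change φ (f • m) = f • φ m
    revert m
    refine smul_induction K (P := fun f => ∀ m, φ (f • m) = f • φ m) hv ha ?_ ?_ ?_ ?_ f
    · simp
    · intro f g hf hg m
      rw [add_smul, map_add, hf, hg, add_smul]
    · intro c f hf m
      rw [smul_assoc, map_smul, hf, smul_assoc]
    · intro f g hf hg m
      rw [mul_smul, hf, hg, mul_smul]

/-- A `K`-subspace stable under the vertex projections and the arrows, as a submodule over the path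
algebra. -/
noncomputable def submoduleOfStable (N : Submodule K M)
    (hv : ∀ (a : V), ∀ m ∈ N, vertexProj K M a m ∈ N)
    (ha : ∀ (a b : V) (α : a ⟶ b), ∀ m ∈ N, pathAct K M α.toPath m ∈ N) :
    Submodule (PathAlgebra K V)ᵐᵒᵖ M where
  __ := N.toAddSubmonoid
  smul_mem' f m hm := by
    change f • m ∈ N
    revert m
    refine smul_induction K (P := fun f => ∀ m ∈ N, f • m ∈ N) hv ha ?_ ?_ ?_ ?_ f
    · simp
    · intro f g hf hg m hm
      rw [add_smul]
      exact N.add_mem (hf m hm) (hg m hm)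
    · intro c f hf m hm
      rw [smul_assoc]
      exact N.smul_mem c (hf m hm)
    · intro f g hf hg m hm
      rw [mul_smul]
      exact hf _ (hg m hm)

theorem mem_submoduleOfStable {N : Submodule K M}
    {hv : ∀ (a : V), ∀ m ∈ N, vertexProj K M a m ∈ N}
    {ha : ∀ (a b : V) (α : a ⟶ b), ∀ m ∈ N, pathAct K M α.toPath m ∈ N} {m : M} :
    m ∈ submoduleOfStable K N hv ha ↔ m ∈ N := Iff.rfl

theorem pathAct_mem (N : Submodule (PathAlgebra K V)ᵐᵒᵖ M) {a b : V} (p : Path a b) {m : M}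
    (hm : m ∈ N) : pathAct K M p m ∈ N :=
  N.smul_mem _ hm

theorem smul_mem_of_mem (N : Submodule (PathAlgebra K V)ᵐᵒᵖ M) (c : K) {m : M}
    (hm : m ∈ N) : c • m ∈ N :=
  (N.restrictScalars K).smul_mem c hm

/-- The sum of the components at the vertices outside a set `S`, provided that no arrow ends in `S`
without starting in `S`. -/
noncomputable def vanishingOn (S : Set V) (hS : ∀ (a b : V), (a ⟶ b) → b ∈ S → a ∈ S) :
    Submodule (PathAlgebra K V)ᵐᵒᵖ M :=
  submoduleOfStable K (⨅ a ∈ S, LinearMap.ker (vertexProj K M a))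
    (by
      intro a m hm
      simp only [Submodule.mem_iInf, LinearMap.mem_ker] at hm ⊢
      intro b hb
      by_cases h : a = b
      · subst h
        rw [vertexProj_vertexProj, hm a hb]
      · exact vertexProj_vertexProj_of_ne K h m)
    (by
      intro a b α m hm
      simp only [Submodule.mem_iInf, LinearMap.mem_ker] at hm ⊢
      intro c hc
      by_cases h : b = c
      · subst h
        rw [vertexProj_pathAct, ← pathAct_vertexProj, hm a (hS a b α hc), map_zero]
      · exact pathAct_pathAct_of_ne K _ _ h m)

theorem mem_vanishingOn {S : Set V} {hS : ∀ (a b : V), (a ⟶ b) → b ∈ S → a ∈ S} {m : M} :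
    m ∈ vanishingOn K (M := M) S hS ↔ ∀ a ∈ S, vertexProj K M a m = 0 := by
  rw [vanishingOn, mem_submoduleOfStable]
  simp only [Submodule.mem_iInf, LinearMap.mem_ker]

end Representation

/-! ### Combinatorics of quivers of type `𝔸_n`. -/

section TypeA

variable {V : Type v} [Quiver.{w} V]

/-- A numbering of the vertices of a quiver by `0, …, n - 1` exhibiting it as a quiver of type
`𝔸_n`. -/
structure IsTypeANumbering (pos : V → ℕ) (n : ℕ) : Prop where
  injective : Function.Injective pos
  lt : ∀ a, pos a < n
  surjective : ∀ i < n, ∃ a, pos a = i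
  adjacent : ∀ {a b : V}, (a ⟶ b) → pos b = pos a + 1 ∨ pos a = pos b + 1
  unique : ∀ {a b : V}, pos b = pos a + 1 → Nonempty (Unique ((a ⟶ b) ⊕ (b ⟶ a)))

theorem IsTypeA.exists_numbering {n : ℕ} (h : IsTypeA V n) :
    ∃ pos : V → ℕ, IsTypeANumbering pos n := by
  obtain ⟨e, he⟩ := h
  refine ⟨fun a => e a, fun a b hab => e.injective (Fin.ext hab), fun a => (e a).2,
    fun i hi => ⟨e.symm ⟨i, hi⟩, by simp⟩, fun {a b} α => ?_, fun {a b} hab => ?_⟩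
  · by_cases hadj : (SimpleGraph.pathGraph n).Adj (e a) (e b)
    · rw [SimpleGraph.pathGraph_adj] at hadj
      omega
    · exact ((he a b).2 hadj).elim α
  · refine (he a b).1 ?_
    rw [SimpleGraph.pathGraph_adj]
    exact Or.inl hab.symm

namespace IsTypeANumbering

variable {pos : V → ℕ} {n : ℕ} (H : IsTypeANumbering pos n)

include H

theorem card_eq [Fintype V] : Fintype.card V = n := by
  have e : V ≃ Fin n := Equiv.ofBijective (fun a => ⟨pos a, H.lt a⟩)
    ⟨fun a b h => H.injective (Fin.mk.inj h),
      fun i => (H.surjective i i.2).imp fun a ha => Fin.ext ha⟩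
  simpa using Fintype.card_congr e

theorem arrow_subsingleton {a b : V} (α β : a ⟶ b) : α = β := by
  rcases H.adjacent α with h | h
  · obtain ⟨hu⟩ := H.unique h
    exact Sum.inl_injective ((hu.uniq (Sum.inl α)).trans (hu.uniq (Sum.inl β)).symm)
  · obtain ⟨hu⟩ := H.unique h
    exact Sum.inr_injective ((hu.uniq (Sum.inr α)).trans (hu.uniq (Sum.inr β)).symm)

theorem no_two_cycle {a b : V} (α : a ⟶ b) (β : b ⟶ a) : False := by
  rcases H.adjacent α with h | h
  · obtain ⟨hu⟩ := H.unique h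
    exact Sum.inl_ne_inr ((hu.uniq (Sum.inl α)).trans (hu.uniq (Sum.inr β)).symm)
  · obtain ⟨hu⟩ := H.unique h
    exact Sum.inl_ne_inr ((hu.uniq (Sum.inl β)).trans (hu.uniq (Sum.inr α)).symm)

theorem exists_arrow {a b : V} (h : pos b = pos a + 1) : Nonempty (a ⟶ b) ∨ Nonempty (b ⟶ a) := by
  obtain ⟨hu⟩ := H.unique h
  exact (hu.default).elim (fun α => Or.inl ⟨α⟩) (fun α => Or.inr ⟨α⟩)

/-- There is a height function on the vertices that increases by one along every arrow. -/
theorem exists_height : ∃ ht : V → ℕ, ∀ {a b : V}, (a ⟶ b) → ht b = ht a + 1 := by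
  classical
  -- Walk along the path, going up or down by one with the direction of each edge. Starting at `n`
  -- keeps the truncated subtraction honest: fewer than `n` steps are taken.
  let f : ℕ → ℕ := fun i => Nat.rec n
    (fun i x => if ∃ a b : V, pos a = i ∧ pos b = i + 1 ∧ Nonempty (a ⟶ b) then x + 1 else x - 1) i
  have hsucc : ∀ i, f (i + 1) =
      if ∃ a b : V, pos a = i ∧ pos b = i + 1 ∧ Nonempty (a ⟶ b) then f i + 1 else f i - 1 :=
    fun _ => rfl
  have hge : ∀ i, n ≤ f i + i := by
    intro i
    induction i with
    | zero => exact le_rfl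
    | succ i ih =>
      rw [hsucc]
      split_ifs <;> omega
  refine ⟨fun a => f (pos a), fun {a b} α => ?_⟩
  simp only
  rcases H.adjacent α with h | h
  · rw [h, hsucc, if_pos ⟨a, b, rfl, h, ⟨α⟩⟩]
  · rw [h, hsucc, if_neg]
    · have h₁ := hge (pos b)
      have h₂ := H.lt a
      omega
    · rintro ⟨c, d, hc, hd, ⟨β⟩⟩
      obtain rfl := H.injective hc
      obtain rfl := H.injective (hd.trans h.symm)
      exact H.no_two_cycle α β

/-- A nontrivial path is determined by its last arrow and the path before it, which ends at smaller
height. -/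
theorem finite_path [Finite V] (a b : V) : Finite (Path a b) := by
  obtain ⟨ht, hht⟩ := H.exists_height
  induction hb : ht b using Nat.strong_induction_on generalizing b with
  | _ m ih =>
    have hfin : ∀ c : V, Finite ((c ⟶ b) × Path a c) := by
      intro c
      have : Subsingleton (c ⟶ b) := ⟨H.arrow_subsingleton⟩
      rcases isEmpty_or_nonempty (c ⟶ b) with _ | ⟨⟨α⟩⟩
      · infer_instance
      · have := ih (ht c) (by have := hht α; omega) c rfl
        infer_instance
    let f : Path a b → Option (Σ c : V, (c ⟶ b) × Path a c) := fun p =>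
      match p with
      | .nil => none
      | .cons q α => some ⟨_, α, q⟩
    refine Finite.of_injective f fun p q hpq => ?_
    cases p with
    | nil =>
      cases q with
      | nil => rfl
      | cons q α => simp [f] at hpq
    | cons p α =>
      cases q with
      | nil => simp [f] at hpq
      | cons q β =>
        simp only [f, Option.some.injEq, Sigma.mk.injEq] at hpq
        obtain ⟨rfl, hpq⟩ := hpq
        rw [heq_eq_eq, Prod.mk.injEq] at hpq
        rw [hpq.1, hpq.2]

/-- A nonempty set of vertices that is not entered by any arrow contains a source. -/
theorem exists_source_mem [Finite V] (S : Set V) (hne : S.Nonempty)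
    (hS : ∀ {a b : V}, (a ⟶ b) → b ∈ S → a ∈ S) : ∃ s ∈ S, ∀ a : V, IsEmpty (a ⟶ s) := by
  obtain ⟨ht, hht⟩ := H.exists_height
  obtain ⟨s, hs, hmin⟩ := S.toFinite.exists_minimalFor ht S hne
  refine ⟨s, hs, fun a => ⟨fun α => ?_⟩⟩
  have h₁ := hht α
  have h₂ := hmin (hS α hs) (by omega)
  omega

/-- A vertex at which two arrows end lies between two sources. -/
theorem exists_two_sources [Finite V] {b : V} (hb : Nontrivial (Costar b)) :
    ∃ s t : V, s ≠ t ∧ (∀ a : V, IsEmpty (a ⟶ s)) ∧ ∀ a : V, IsEmpty (a ⟶ t) := by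
  obtain ⟨⟨c, α⟩, ⟨d, β⟩, hne⟩ := hb
  have hcd : c ≠ d := by
    rintro rfl
    exact hne (by rw [H.arrow_subsingleton α β])
  wlog hlt : pos c < pos d generalizing c d
  · exact this d β c α hne.symm hcd.symm
      (lt_of_le_of_ne (not_lt.mp hlt) fun h => hcd (H.injective h.symm))
  have hα := H.adjacent α
  have hβ := H.adjacent β
  -- The only edge joining this side to the rest is `c ⟶ b`, which leaves it; so no arrow enters,
  -- and the side contains a source. The other side is symmetric.
  obtain ⟨s, hs, hs'⟩ := H.exists_source_mem {a | pos a < pos b}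
    ⟨c, show pos c < pos b by omega⟩ (by
      intro x y γ hy
      by_contra hx
      simp only [Set.mem_ofPred_eq] at hx hy
      have hγ := H.adjacent γ
      obtain rfl : y = c := H.injective (by omega)
      obtain rfl : x = b := H.injective (by omega)
      exact H.no_two_cycle α γ)
  obtain ⟨t, ht, ht'⟩ := H.exists_source_mem {a | pos b < pos a}
    ⟨d, show pos b < pos d by omega⟩ (by
      intro x y γ hy
      by_contra hx
      simp only [Set.mem_ofPred_eq] at hx hy
      have hγ := H.adjacent γ
      obtain rfl : y = d := H.injective (by omega)
      obtain rfl : x = b := H.injective (by omega)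
      exact H.no_two_cycle β γ)
  refine ⟨s, t, ?_, hs', ht'⟩
  rintro rfl
  simp only [Set.mem_ofPred_eq] at hs ht
  omega

/-- If no two arrows end in the same vertex, a vertex at which two arrows start is the only
source. -/
theorem exists_arrow_to [Finite V] (hcostar : ∀ a : V, Subsingleton (Costar a)) {b : V}
    (hb : Nontrivial (Star b)) {s : V} (hs : s ≠ b) : ∃ c : V, Nonempty (c ⟶ s) := by
  by_contra! hsource
  obtain ⟨ht, hht⟩ := H.exists_height
  obtain ⟨⟨c, α⟩, ⟨d, β⟩, hne⟩ := hb
  have hcd : pos c ≠ pos d := by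
    intro h
    obtain rfl := H.injective h
    exact hne (by rw [H.arrow_subsingleton α β])
  have hsb : pos s ≠ pos b := fun h => hs (H.injective h)
  have hα := H.adjacent α
  have hβ := H.adjacent β
  have hhα := hht α
  have hhβ := hht β
  -- A vertex `t` of maximal height on the segment from `b` to a second source `s` receives arrows
  -- from all its neighbours there. It is not `b`, which has a higher neighbour in `S`, nor the
  -- source `s`; as an interior vertex it receives two arrows.
  let S : Set V := {a | (pos b ≤ pos a ∧ pos a ≤ pos s) ∨ (pos s ≤ pos a ∧ pos a ≤ pos b)}
  have hS : ∀ a, a ∈ S ↔ (pos b ≤ pos a ∧ pos a ≤ pos s) ∨ (pos s ≤ pos a ∧ pos a ≤ pos b) :=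
    fun _ => Iff.rfl
  obtain ⟨t, htS, hmax⟩ := S.toFinite.exists_maximalFor ht S ⟨b, by rw [hS]; omega⟩
  have hmax' : ∀ x ∈ S, ht x ≤ ht t := fun x hx => by
    by_contra h
    exact h (hmax hx (by omega))
  have hslt := H.lt s
  have hblt := H.lt b
  have htb : pos t ≠ pos b := by
    intro h
    obtain rfl := H.injective h
    have h₁ : c ∈ S ∨ d ∈ S := by
      rw [hS, hS]
      omega
    rcases h₁ with h₁ | h₁
    · have := hmax' _ h₁
      omega
    · have := hmax' _ h₁
      omega
  have hinto : ∀ x ∈ S, (pos x = pos t + 1 ∨ pos t = pos x + 1) → Nonempty (x ⟶ t) := by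
    intro x hx h
    have key : IsEmpty (t ⟶ x) := ⟨fun γ => by
      have h₁ := hht γ
      have h₂ := hmax' x hx
      omega⟩
    rcases h with h | h
    · exact (H.exists_arrow h).resolve_left (not_nonempty_iff.mpr key)
    · exact (H.exists_arrow h).resolve_right (not_nonempty_iff.mpr key)
  rw [hS] at htS
  have hts : pos t ≠ pos s := by
    intro h
    obtain rfl := H.injective h
    obtain ⟨x, hx⟩ := H.surjective (if pos b < pos t then pos t - 1 else pos t + 1)
      (by split_ifs <;> omega)
    have hx' : x ∈ S ∧ (pos x = pos t + 1 ∨ pos t = pos x + 1) := by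
      rw [hS]
      split_ifs at hx <;> omega
    obtain ⟨γ⟩ := hinto x hx'.1 hx'.2
    exact (hsource x).elim γ
  obtain ⟨x, hx⟩ := H.surjective (pos t - 1) (by omega)
  obtain ⟨y, hy⟩ := H.surjective (pos t + 1) (by omega)
  obtain ⟨γ⟩ := hinto x (by rw [hS]; omega) (by omega)
  obtain ⟨δ⟩ := hinto y (by rw [hS]; omega) (by omega)
  have := hcostar t
  have heq : (⟨x, γ⟩ : Costar t) = ⟨y, δ⟩ := Subsingleton.elim _ _
  have hxy : x = y := congrArg Sigma.fst heq
  subst hxy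
  omega

end IsTypeANumbering

end TypeA

/-! ### Gluing endomorphisms of components. -/

section Components

variable (K : Type u) [CommRing K] {V : Type v} [Quiver.{w} V] [Fintype V]
  {M : Type*} [AddCommGroup M] [Module K M] [Module (PathAlgebra K V)ᵐᵒᵖ M]
  [IsScalarTower K (PathAlgebra K V)ᵐᵒᵖ M]

/-- Endomorphisms of the components of a module that are compatible with the arrows glue to an
endomorphism of the module. -/
theorem exists_end_of_components (Ψ : V → M →ₗ[K] M)
    (hΨ : ∀ a, ∀ x ∈ vertexSpace K M a, Ψ a x ∈ vertexSpace K M a)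
    (harrow : ∀ (a b : V) (α : a ⟶ b), ∀ x ∈ vertexSpace K M a,
      Ψ b (pathAct K M α.toPath x) = pathAct K M α.toPath (Ψ a x)) :
    ∃ f : M →ₗ[(PathAlgebra K V)ᵐᵒᵖ] M, ∀ a : V, ∀ x ∈ vertexSpace K M a, f x = Ψ a x := by
  let φ : M →ₗ[K] M := ∑ a, Ψ a ∘ₗ vertexProj K M a
  have hφ : ∀ m, φ m = ∑ a, Ψ a (vertexProj K M a m) := fun m => by
    simp [φ, LinearMap.sum_apply]
  have hmem : ∀ (a : V) (m : M), vertexProj K M a m ∈ vertexSpace K M a := fun a m => ⟨m, rfl⟩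
  have hφv : ∀ a : V, ∀ x ∈ vertexSpace K M a, φ x = Ψ a x := by
    intro a x hx
    rw [hφ, Finset.sum_eq_single a, (mem_vertexSpace K).mp hx]
    · intro b _ hb
      rw [vertexProj_of_mem_of_ne K hb.symm hx, map_zero]
    · simp
  have hproj : ∀ (a : V) (m : M), vertexProj K M a (φ m) = Ψ a (vertexProj K M a m) := by
    intro a m
    rw [hφ, map_sum, Finset.sum_eq_single a, (mem_vertexSpace K).mp (hΨ a _ (hmem a m))]
    · intro b _ hb
      exact vertexProj_of_mem_of_ne K hb (hΨ b _ (hmem b m))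
    · simp
  refine ⟨endOfCommute K φ ?_ ?_, fun a x hx => hφv a x hx⟩
  · intro a m
    rw [hproj, hφv a _ (hmem a m)]
  · intro a b α m
    rw [hφv b _ (pathAct_mem_vertexSpace K _ m), ← pathAct_vertexProj, harrow a b α _ (hmem a m),
      ← hproj, pathAct_vertexProj]

end Components

/-! ### Indecomposable modules of type `𝔸_n` are thin. -/

section Dimension

variable (K : Type u) [Field K] {V : Type v} [Quiver.{w} V] [Fintype V]
  {M : Type*} [AddCommGroup M] [Module K M] [Module (PathAlgebra K V)ᵐᵒᵖ M]
  [IsScalarTower K (PathAlgebra K V)ᵐᵒᵖ M]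

theorem length_le_finrank [FiniteDimensional K M] :
    Module.length (PathAlgebra K V)ᵐᵒᵖ M ≤ Module.finrank K M := by
  rw [← Module.length_top, ← Module.length_eq_finrank, ← Module.length_top (R := K)]
  exact Submodule.length_le_length_restrictScalars K ⊤

theorem finrank_le_sum_finrank_vertexSpace [FiniteDimensional K M] :
    Module.finrank K M ≤ ∑ a : V, Module.finrank K (vertexSpace K M a) := by
  rw [← Module.finrank_pi_fintype K]
  refine LinearMap.finrank_le_finrank_of_injective
    (f := LinearMap.pi fun a : V => (vertexProj K M a).rangeRestrict) ?_
  intro x y hxy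
  rw [← sum_vertexProj (V := V) K x, ← sum_vertexProj (V := V) K y]
  exact Finset.sum_congr rfl fun a _ => congrArg Subtype.val (congrFun hxy a)

variable {K}

/-- The components of an indecomposable module over a path algebra of type `𝔸_n` have dimension at
most one. -/
theorem IsIndecomposableModule.finrank_vertexSpace_le_one [FiniteDimensional K M] {pos : V → ℕ}
    {n : ℕ} (H : IsTypeANumbering pos n) [IsNoetherian (PathAlgebra K V)ᵐᵒᵖ M]
    [IsArtinian (PathAlgebra K V)ᵐᵒᵖ M] (hM : IsIndecomposableModule (PathAlgebra K V)ᵐᵒᵖ M)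
    (a : V) : Module.finrank K (vertexSpace K M a) ≤ 1 := by
  by_contra! hlt
  -- The component at position `i`, written as an intersection of kernels so that it makes sense for
  -- every natural number.
  let W : ℕ → Submodule K M := fun i =>
    ⨅ b : V, ⨅ _ : pos b ≠ i, LinearMap.ker (vertexProj K M b)
  have hW : ∀ b : V, W (pos b) = vertexSpace K M b := by
    intro b
    ext m
    simp only [W, Submodule.mem_iInf, LinearMap.mem_ker]
    constructor
    · intro h
      rw [mem_vertexSpace]
      conv_rhs => rw [← sum_vertexProj (V := V) K m]
      rw [Finset.sum_eq_single b]
      · exact fun c _ hc => h c fun h' => hc (H.injective h')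
      · simp
    · exact fun hm c hc => vertexProj_of_mem_of_ne K (fun h : b = c => hc (by rw [h])) hm
  -- The graph of the arrow between positions `i` and `i + 1`, transposed if the arrow points back;
  -- relations treat both orientations alike.
  let L : ℕ → Submodule K (M × M) := fun i =>
    { carrier := {p | p.1 ∈ W i ∧ p.2 ∈ W (i + 1) ∧ ∀ (b c : V) (α : b ⟶ c),
        (pos b = i → pos c = i + 1 → pathAct K M α.toPath p.1 = p.2) ∧
        (pos c = i → pos b = i + 1 → pathAct K M α.toPath p.2 = p.1)}
      zero_mem' := ⟨Submodule.zero_mem _, Submodule.zero_mem _, fun b c α =>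
        ⟨fun _ _ => map_zero _, fun _ _ => map_zero _⟩⟩
      add_mem' := by
        rintro p q ⟨hp₁, hp₂, hp⟩ ⟨hq₁, hq₂, hq⟩
        refine ⟨Submodule.add_mem _ hp₁ hq₁, Submodule.add_mem _ hp₂ hq₂, fun b c α =>
          ⟨fun h h' => ?_, fun h h' => ?_⟩⟩
        · rw [Prod.fst_add, Prod.snd_add, map_add, (hp b c α).1 h h', (hq b c α).1 h h']
        · rw [Prod.fst_add, Prod.snd_add, map_add, (hp b c α).2 h h', (hq b c α).2 h h']
      smul_mem' := by
        rintro x p ⟨hp₁, hp₂, hp⟩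
        refine ⟨Submodule.smul_mem _ x hp₁, Submodule.smul_mem _ x hp₂, fun b c α =>
          ⟨fun h h' => ?_, fun h h' => ?_⟩⟩
        · rw [Prod.smul_fst, Prod.smul_snd, map_smul, (hp b c α).1 h h']
        · rw [Prod.smul_fst, Prod.smul_snd, map_smul, (hp b c α).2 h h'] }
  have hL : ∀ i x y, (x, y) ∈ L i ↔ x ∈ W i ∧ y ∈ W (i + 1) ∧ ∀ (b c : V) (α : b ⟶ c),
        (pos b = i → pos c = i + 1 → pathAct K M α.toPath x = y) ∧
        (pos c = i → pos b = i + 1 → pathAct K M α.toPath y = x) := fun _ _ _ => Iff.rfl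
  have hpos := H.lt a
  obtain ⟨Φ, hΦW, hΦL, ⟨x, hxW, hx0, hΦx⟩, y, hyW, hy0, hΦy⟩ :=
    exists_zigzag_endomorphism W L (fun i p hp => hp.1) (fun i p hp => hp.2.1)
      (k := pos a) (N := n - 1) (by omega) (by rw [hW]; exact hlt)
  obtain ⟨f, hf⟩ := exists_end_of_components K (fun b => Φ (pos b))
    (fun b z hz => by
      rw [← hW] at hz ⊢
      have := H.lt b
      exact hΦW (pos b) (by omega) z hz)
    (by
      intro b c α z hz
      have hb := H.lt b
      have hc := H.lt c
      have hαz := pathAct_mem_vertexSpace K α.toPath z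
      rw [← hW] at hz hαz
      rcases H.adjacent α with h | h
      · have hmem : (z, pathAct K M α.toPath z) ∈ L (pos b) := by
          rw [hL]
          refine ⟨hz, h ▸ hαz, fun b' c' β => ⟨fun h₁ h₂ => ?_, fun h₁ h₂ => ?_⟩⟩
          · obtain rfl := H.injective h₁
            obtain rfl := H.injective (h₂.trans h.symm)
            rw [H.arrow_subsingleton β α]
          · obtain rfl := H.injective h₁
            obtain rfl := H.injective (h₂.trans h.symm)
            exact (H.no_two_cycle α β).elim
        have := ((hL _ _ _).mp (hΦL (pos b) (by omega) _ hmem)).2.2 b c α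
        rw [h]
        exact (this.1 rfl h).symm
      · have hmem : (pathAct K M α.toPath z, z) ∈ L (pos c) := by
          rw [hL]
          refine ⟨hαz, h ▸ hz, fun b' c' β => ⟨fun h₁ h₂ => ?_, fun h₁ h₂ => ?_⟩⟩
          · obtain rfl := H.injective h₁
            obtain rfl := H.injective (h₂.trans h.symm)
            exact (H.no_two_cycle α β).elim
          · obtain rfl := H.injective h₁
            obtain rfl := H.injective (h₂.trans h.symm)
            rw [H.arrow_subsingleton β α]
        have := ((hL _ _ _).mp (hΦL (pos c) (by omega) _ hmem)).2.2 b c α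
        rw [h]
        exact (this.2 rfl h).symm)
  rw [hW] at hxW hyW
  exact hy0 (hM.ker_eq_bot_of_fixed f hx0 ((hf a x hxW).trans hΦx) y ((hf a y hyW).trans hΦy))

/-- The arrows act nontrivially on an indecomposable module with full support over a path algebra
of type `𝔸_n`. -/
theorem IsIndecomposableModule.exists_pathAct_ne_zero {pos : V → ℕ}
    {n : ℕ} (H : IsTypeANumbering pos n) [IsNoetherian (PathAlgebra K V)ᵐᵒᵖ M]
    [IsArtinian (PathAlgebra K V)ᵐᵒᵖ M] (hM : IsIndecomposableModule (PathAlgebra K V)ᵐᵒᵖ M)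
    (hfull : ∀ a : V, vertexSpace K M a ≠ ⊥) {a b : V} (α : a ⟶ b) :
    ∃ m, pathAct K M α.toPath m ≠ 0 := by
  by_contra! hzero
  have hadj := H.adjacent α
  -- Cut the path at the edge of `α`: identity on one side, zero on the other. This is an
  -- endomorphism because the only arrow across the cut acts as zero.
  obtain ⟨f, hf⟩ := exists_end_of_components K
    (fun c => if pos c ≤ min (pos a) (pos b) then (LinearMap.id : M →ₗ[K] M) else 0)
    (fun c x hx => by
      split_ifs
      · exact hx
      · exact Submodule.zero_mem _)
    (by
      intro c d γ x hx
      have hγ := H.adjacent γ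
      by_cases h : c = a ∧ d = b
      · obtain ⟨rfl, rfl⟩ := h
        rw [H.arrow_subsingleton γ α, hzero, hzero, map_zero]
      · by_cases h' : c = b ∧ d = a
        · obtain ⟨rfl, rfl⟩ := h'
          exact (H.no_two_cycle α γ).elim
        · have hiff : pos c ≤ min (pos a) (pos b) ↔ pos d ≤ min (pos a) (pos b) := by
            have h₁ : ¬ (pos c = pos a ∧ pos d = pos b) := fun ⟨h₁, h₂⟩ =>
              h ⟨H.injective h₁, H.injective h₂⟩
            have h₂ : ¬ (pos c = pos b ∧ pos d = pos a) := fun ⟨h₁, h₂⟩ =>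
              h' ⟨H.injective h₁, H.injective h₂⟩
            omega
          by_cases hc : pos c ≤ min (pos a) (pos b)
          · simp only [hc, hiff.mp hc, if_true, LinearMap.id_apply]
          · have hd := fun h => hc (hiff.mpr h)
            simp only [if_neg hc, if_neg hd, LinearMap.zero_apply, map_zero])
  obtain ⟨x, hx, hx0⟩ := (Submodule.ne_bot_iff _).mp (hfull a)
  obtain ⟨y, hy, hy0⟩ := (Submodule.ne_bot_iff _).mp (hfull b)
  have hfx := hf a x hx
  have hfy := hf b y hy
  rcases hadj with h | h
  · rw [if_pos (by omega)] at hfx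
    rw [if_neg (by omega)] at hfy
    exact hy0 (hM.ker_eq_bot_of_fixed f hx0 hfx y hfy)
  · rw [if_neg (by omega)] at hfx
    rw [if_pos (by omega)] at hfy
    exact hx0 (hM.ker_eq_bot_of_fixed f hy0 hfy x hfx)

end Dimension

/-! ### Modules with a line at every vertex and nonzero arrows. -/

section FullThin

variable (K : Type u) [Field K] {V : Type v} [Quiver.{w} V] [Fintype V]
  (M : Type*) [AddCommGroup M] [Module K M] [Module (PathAlgebra K V)ᵐᵒᵖ M]
  [IsScalarTower K (PathAlgebra K V)ᵐᵒᵖ M]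

/-- Modules over a path algebra all of whose components are one-dimensional and on which all arrows
act nontrivially. -/
structure IsFullThin : Prop where
  finrank_eq_one : ∀ a : V, Module.finrank K (vertexSpace K M a) = 1
  exists_ne_zero : ∀ {a b : V} (α : a ⟶ b), ∃ m, pathAct K M α.toPath m ≠ 0

variable {K M}

namespace IsFullThin

variable (h : IsFullThin K (V := V) M)

include h

theorem exists_mem_ne_zero (a : V) : ∃ x ∈ vertexSpace K M a, x ≠ 0 := by
  refine (Submodule.ne_bot_iff _).mp fun hbot => ?_
  have := h.finrank_eq_one a
  rw [hbot, finrank_bot] at this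
  omega

theorem vertexSpace_le_of_mem (N : Submodule (PathAlgebra K V)ᵐᵒᵖ M) {a : V} {x : M} (hx : x ∈ N)
    (hxa : x ∈ vertexSpace K M a) (hx0 : x ≠ 0) : vertexSpace K M a ≤ N.restrictScalars K := by
  intro y hy
  obtain ⟨c, hc⟩ := exists_smul_eq_of_finrank_eq_one (h.finrank_eq_one a)
    (x := ⟨x, hxa⟩) (fun h' => hx0 (congrArg Subtype.val h')) ⟨y, hy⟩
  rw [← show c • x = y from congrArg Subtype.val hc]
  exact smul_mem_of_mem K N c hx

theorem vertexSpace_le_of_vertexProj_ne_zero (N : Submodule (PathAlgebra K V)ᵐᵒᵖ M) {a : V} {m : M}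
    (hm : m ∈ N) (hma : vertexProj K M a m ≠ 0) : vertexSpace K M a ≤ N.restrictScalars K :=
  h.vertexSpace_le_of_mem N (pathAct_mem K N _ hm) ⟨m, rfl⟩ hma

theorem vertexSpace_le_of_arrow (N : Submodule (PathAlgebra K V)ᵐᵒᵖ M) {a b : V} (α : a ⟶ b)
    (ha : vertexSpace K M a ≤ N.restrictScalars K) :
    vertexSpace K M b ≤ N.restrictScalars K := by
  obtain ⟨m, hm⟩ := h.exists_ne_zero α
  rw [← pathAct_vertexProj] at hm
  exact h.vertexSpace_le_of_mem N (pathAct_mem K N α.toPath (ha ⟨m, rfl⟩))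
    (pathAct_mem_vertexSpace K _ _) hm

omit h in
theorem eq_top_of_forall_vertexSpace_le {N : Submodule (PathAlgebra K V)ᵐᵒᵖ M}
    (hN : ∀ a : V, vertexSpace K M a ≤ N.restrictScalars K) : N = ⊤ := by
  rw [eq_top_iff]
  intro m _
  rw [← sum_vertexProj (V := V) K m]
  exact N.sum_mem fun a _ => hN a ⟨m, rfl⟩

theorem not_vanishingOn_le {S T : Set V} {hS : ∀ (a b : V), (a ⟶ b) → b ∈ S → a ∈ S}
    {hT : ∀ (a b : V), (a ⟶ b) → b ∈ T → a ∈ T} {a : V} (haS : a ∉ S) (haT : a ∈ T) :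
    ¬ vanishingOn K (M := M) S hS ≤ vanishingOn K T hT := by
  intro hle
  obtain ⟨x, hx, hx0⟩ := h.exists_mem_ne_zero a
  have hxS : x ∈ vanishingOn K (M := M) S hS := by
    rw [mem_vanishingOn]
    intro b hb
    exact vertexProj_of_mem_of_ne K (fun hab : a = b => haS (hab ▸ hb)) hx
  have := (mem_vanishingOn K).mp (hle hxS) a haT
  rw [(mem_vertexSpace K).mp hx] at this
  exact hx0 this

/-- The two submodules differ by the component at `x`, which is a line: a submodule strictly above
the smaller one has an element with nonzero `x`-component and so contains that whole line. -/
theorem vanishingOn_insert_covBy {S : Set V} {hS : ∀ (a b : V), (a ⟶ b) → b ∈ S → a ∈ S} {x : V}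
    (hx : x ∉ S) (hS' : ∀ (a b : V), (a ⟶ b) → b ∈ insert x S → a ∈ insert x S) :
    vanishingOn K (M := M) (insert x S) hS' ⋖ vanishingOn K S hS := by
  refine ⟨lt_of_le_not_ge ?_ (h.not_vanishingOn_le hx (Set.mem_insert x S)), ?_⟩
  · intro m hm
    rw [mem_vanishingOn] at hm ⊢
    exact fun a ha => hm a (Set.mem_insert_of_mem x ha)
  · intro N hlt hlt'
    obtain ⟨m, hmN, hm⟩ := SetLike.exists_of_lt hlt
    have hmS := hlt'.le hmN
    rw [mem_vanishingOn] at hm hmS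
    have hmx : vertexProj K M x m ≠ 0 := by
      intro h0
      refine hm fun a ha => ?_
      obtain rfl | ha := Set.mem_insert_iff.mp ha
      · exact h0
      · exact hmS a ha
    have hxN := h.vertexSpace_le_of_vertexProj_ne_zero N hmN hmx
    refine hlt'.not_ge fun y hy => ?_
    rw [mem_vanishingOn] at hy
    have hy' : y - vertexProj K M x y ∈ vanishingOn K (M := M) (insert x S) hS' := by
      rw [mem_vanishingOn]
      intro a ha
      by_cases hax : a = x
      · subst hax
        rw [map_sub, vertexProj_vertexProj, sub_self]
      · rw [map_sub, vertexProj_vertexProj_of_ne K (Ne.symm hax), sub_zero]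
        exact hy a ((Set.mem_insert_iff.mp ha).resolve_left hax)
    have := N.add_mem (hlt.le hy') (hxN ⟨y, rfl⟩)
    rwa [sub_add_cancel] at this

/-- Modules with one-dimensional components connected by nonzero arrows are indecomposable. -/
theorem isIndecomposableModule {pos : V → ℕ} {n : ℕ} (hn : 0 < n) (H : IsTypeANumbering pos n) :
    IsIndecomposableModule (PathAlgebra K V)ᵐᵒᵖ M := by
  obtain ⟨o, ho⟩ := H.surjective 0 hn
  obtain ⟨z, hz, hz0⟩ := h.exists_mem_ne_zero o
  refine ⟨⟨z, 0, hz0⟩, ?_⟩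
  -- A component is a line, so a nonzero projection to it from either summand puts all of it in that
  -- summand.
  have hdich : ∀ A B : Submodule (PathAlgebra K V)ᵐᵒᵖ M, IsCompl A B → ∀ a : V,
      vertexSpace K M a ≤ A.restrictScalars K ∨ vertexSpace K M a ≤ B.restrictScalars K := by
    intro A B hAB a
    obtain ⟨x, hx, hx0⟩ := h.exists_mem_ne_zero a
    obtain ⟨y, hy, t, ht, hyt⟩ := Submodule.mem_sup.mp
      (show x ∈ A ⊔ B by rw [hAB.sup_eq_top]; trivial)
    rw [← (mem_vertexSpace K).mp hx, ← hyt, map_add] at hx0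
    by_cases hy0 : vertexProj K M a y = 0
    · rw [hy0, zero_add] at hx0
      exact Or.inr (h.vertexSpace_le_of_vertexProj_ne_zero B ht hx0)
    · exact Or.inl (h.vertexSpace_le_of_vertexProj_ne_zero A hy hy0)
  have hmain : ∀ A B : Submodule (PathAlgebra K V)ᵐᵒᵖ M, IsCompl A B →
      vertexSpace K M o ≤ A.restrictScalars K → B = ⊥ := by
    intro A B hAB hoA
    have hall : ∀ i, ∀ a, pos a = i → vertexSpace K M a ≤ A.restrictScalars K := by
      intro i
      induction i with
      | zero =>
        intro a ha
        obtain rfl := H.injective (ha.trans ho.symm)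
        exact hoA
      | succ i ih =>
        intro a ha
        have hlt := H.lt a
        obtain ⟨c, hc⟩ := H.surjective i (by omega)
        rcases H.exists_arrow (a := c) (b := a) (by omega) with ⟨⟨α⟩⟩ | ⟨⟨α⟩⟩
        · exact h.vertexSpace_le_of_arrow A α (ih c hc)
        -- Here the arrow runs from `a` back to `c`; if the line at `a` were in `B`, its nonzero
        -- image at `c` would lie in both summands.
        · refine (hdich A B hAB a).resolve_right fun haB => ?_
          obtain ⟨x, hx, hx0⟩ := h.exists_mem_ne_zero c
          have : x ∈ A ⊓ B := ⟨ih c hc hx, h.vertexSpace_le_of_arrow B α haB hx⟩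
          rw [hAB.inf_eq_bot, Submodule.mem_bot] at this
          exact hx0 this
    have hA := eq_top_of_forall_vertexSpace_le fun a => hall _ a rfl
    have := hAB.inf_eq_bot
    rwa [hA, top_inf_eq] at this
  intro A B hAB
  exact (hdich A B hAB o).elim (fun ho => Or.inr (hmain A B hAB ho))
    (fun ho => Or.inl (hmain B A hAB.symm ho))

/-- The dimension bounds the length from above. From below, removing vertices in order of increasing
height gives a strict chain of submodules, since no arrow enters the removed set. -/
theorem length_eq [FiniteDimensional K M] {pos : V → ℕ} {n : ℕ} (H : IsTypeANumbering pos n) :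
    Module.length (PathAlgebra K V)ᵐᵒᵖ M = n := by
  refine le_antisymm ?_ ?_
  · refine (length_le_finrank K).trans (Nat.cast_le.mpr ?_)
    refine (finrank_le_sum_finrank_vertexSpace (V := V) K).trans ?_
    simp [h.finrank_eq_one, H.card_eq]
  · have key : ∀ (k : ℕ) (S : Finset V)
        (hS : ∀ (a b : V), (a ⟶ b) → b ∈ (S : Set V) → a ∈ (S : Set V)), S.card + k = n →
        (k : ℕ∞) ≤ Order.height (vanishingOn K (M := M) (S : Set V) hS) := by
      classical
      intro k
      induction k with
      | zero => simp
      | succ k ih =>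
        intro S hS hcard
        have hne : (Sᶜ : Finset V).Nonempty := by
          rw [← Finset.card_pos, Finset.card_compl, H.card_eq]
          omega
        obtain ⟨ht, hht⟩ := H.exists_height
        obtain ⟨x, hx, hmin⟩ := Finset.exists_min_image _ ht hne
        rw [Finset.mem_compl] at hx
        have hS' : ∀ (a b : V), (a ⟶ b) → b ∈ ((insert x S : Finset V) : Set V) →
            a ∈ ((insert x S : Finset V) : Set V) := by
          intro a b α hb
          rw [Finset.coe_insert] at hb ⊢
          obtain rfl | hb := Set.mem_insert_iff.mp hb
          · by_contra ha
            have h₁ := hht α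
            have h₂ := hmin a (by
              rw [Finset.mem_compl]
              exact fun h' => ha (Set.mem_insert_of_mem _ h'))
            omega
          · exact Set.mem_insert_of_mem _ (hS a b α hb)
        have h₁ := ih (insert x S) hS' (by rw [Finset.card_insert_of_notMem hx]; omega)
        have hlt : vanishingOn K (M := M) ((insert x S : Finset V) : Set V) hS' <
            vanishingOn K (S : Set V) hS := by
          simp only [Finset.coe_insert] at hS' ⊢
          exact (h.vanishingOn_insert_covBy (by simpa using hx) hS').lt
        refine le_trans ?_ (Order.height_add_one_le hlt)
        rw [Nat.cast_succ]
        gcongr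
    rw [Module.length_eq_height]
    refine (key n ∅ (by simp) (by simp)).trans (Order.height_mono le_top)

/-- If there is only one source, the proper submodules are those vanishing at the source. -/
theorem le_vanishingOn_of_ne_top {pos : V → ℕ} {n : ℕ} (H : IsTypeANumbering pos n)
    {b : V} (hb : ∀ a, a ≠ b → ∃ c : V, Nonempty (c ⟶ a))
    {hS : ∀ (x y : V), (x ⟶ y) → y ∈ ({b} : Set V) → x ∈ ({b} : Set V)}
    {N : Submodule (PathAlgebra K V)ᵐᵒᵖ M} (hN : N ≠ ⊤) : N ≤ vanishingOn K {b} hS := by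
  intro m hm
  rw [mem_vanishingOn]
  intro b' hb'
  rw [Set.mem_singleton_iff.mp hb']
  by_contra hmb
  -- A submodule seeing the source `b` contains its line; every other line is then reached by
  -- induction on height, through an arrow from a lower vertex.
  refine hN (eq_top_of_forall_vertexSpace_le fun a => ?_)
  obtain ⟨ht, hht⟩ := H.exists_height
  induction ha : ht a using Nat.strong_induction_on generalizing a with
  | _ k ih =>
    by_cases hab : a = b
    · subst hab
      exact h.vertexSpace_le_of_vertexProj_ne_zero N hm hmb
    · obtain ⟨c, ⟨α⟩⟩ := hb a hab
      exact h.vertexSpace_le_of_arrow N α (ih (ht c) (by have := hht α; omega) c rfl)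

end IsFullThin

end FullThin

/-! ### The constant representation, a full thin module. -/

section ConstantRepresentation

/-- The representation of a quiver with the one-dimensional space `K` at every vertex and the
identity at every arrow, as a right module over the path algebra. -/
def ConstantRep (K : Type u) (V : Type v) [Quiver.{w} V] : Type (max u v w) :=
  -- Lifted to the universe of the path algebra, where `IsRightNakayama` asks for its witness.
  ULift.{w} (V → K)

namespace ConstantRep

variable {K : Type u} {V : Type v} [Quiver.{w} V]

section Ring

variable [CommRing K]

instance : AddCommGroup (ConstantRep K V) :=
  inferInstanceAs (AddCommGroup (ULift.{w} (V → K)))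

instance : Module K (ConstantRep K V) :=
  inferInstanceAs (Module K (ULift.{w} (V → K)))

variable (K V) in
/-- The coordinates of an element of the constant representation. -/
def coord : ConstantRep K V ≃ₗ[K] (V → K) := ULift.moduleEquiv

theorem ext_coord {s t : ConstantRep K V} (h : ∀ a, coord K V s a = coord K V t a) : s = t :=
  (coord K V).injective (funext h)

/-- The sum of the coefficients of a linear combination of paths. -/
noncomputable def augmentation (K : Type u) [CommRing K] (a b : V) : (Path a b →₀ K) →ₗ[K] K :=
  Finsupp.linearCombination K fun _ => 1

theorem augmentation_single {a b : V} (p : Path a b) (x : K) :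
    augmentation K a b (Finsupp.single p x) = x := by
  simp [augmentation]

/-- This multiplicativity is what makes the action on the constant representation associative. -/
theorem augmentation_pathConcat {a b c : V} (f : Path a b →₀ K) (g : Path b c →₀ K) :
    augmentation K a c (pathConcat K a b c f g) = augmentation K a b f * augmentation K b c g := by
  induction f using Finsupp.induction_linear with
  | zero => simp
  | add f₁ f₂ h₁ h₂ => simp [h₁, h₂, add_mul]
  | single p x =>
    induction g using Finsupp.induction_linear with
    | zero => simp
    | add g₁ g₂ h₁ h₂ => simp only [map_add, h₁, h₂, mul_add]
    | single q y => simp only [PathAlgebra.pathConcat_single, augmentation_single]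

variable [Fintype V]

noncomputable instance : SMul (PathAlgebra K V)ᵐᵒᵖ (ConstantRep K V) where
  smul f t := (coord K V).symm fun c => ∑ a : V, augmentation K a c (f.unop a c) * coord K V t a

theorem coord_smul (f : (PathAlgebra K V)ᵐᵒᵖ) (t : ConstantRep K V) (c : V) :
    coord K V (f • t) c = ∑ a : V, augmentation K a c (f.unop a c) * coord K V t a := rfl

noncomputable instance : Module (PathAlgebra K V)ᵐᵒᵖ (ConstantRep K V) where
  one_smul t := ext_coord fun c => by
    rw [coord_smul, Finset.sum_eq_single c, MulOpposite.unop_one, PathAlgebra.one_apply_self,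
      augmentation_single, one_mul]
    · intro a _ ha
      rw [MulOpposite.unop_one, PathAlgebra.one_apply_ne ha, map_zero, zero_mul]
    · simp
  mul_smul f g t := ext_coord fun c => by
    simp only [coord_smul, MulOpposite.unop_mul, PathAlgebra.mul_apply, map_sum,
      augmentation_pathConcat, Finset.sum_mul, Finset.mul_sum]
    rw [Finset.sum_comm]
    exact Finset.sum_congr rfl fun a _ => Finset.sum_congr rfl fun b _ => by ring
  smul_zero f := ext_coord fun c => by simp [coord_smul]
  smul_add f s t := ext_coord fun c => by
    simp [coord_smul, mul_add, Finset.sum_add_distrib]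
  add_smul f g t := ext_coord fun c => by
    simp [coord_smul, PathAlgebra.add_apply, add_mul, Finset.sum_add_distrib]
  zero_smul t := ext_coord fun c => by
    simp [coord_smul, PathAlgebra.zero_apply]

instance : IsScalarTower K (PathAlgebra K V)ᵐᵒᵖ (ConstantRep K V) where
  smul_assoc x f t := ext_coord fun c => by
    simp [coord_smul, PathAlgebra.smul_apply, Finset.mul_sum, mul_assoc]

theorem coord_pathAct_target {a b : V} (p : Path a b) (t : ConstantRep K V) :
    coord K V (pathAct K _ p t) b = coord K V t a := by
  rw [pathAct_apply, coord_smul, Finset.sum_eq_single a]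
  · rw [MulOpposite.unop_op, PathAlgebra.ofPath_apply_self, augmentation_single, one_mul]
  · intro c _ hc
    rw [MulOpposite.unop_op, PathAlgebra.ofPath_apply_source_ne p hc, map_zero, zero_mul]
  · simp

theorem coord_pathAct_of_ne {a b c : V} (p : Path a b) (t : ConstantRep K V) (h : c ≠ b) :
    coord K V (pathAct K _ p t) c = 0 := by
  rw [pathAct_apply, coord_smul]
  refine Finset.sum_eq_zero fun d _ => ?_
  rw [MulOpposite.unop_op, PathAlgebra.ofPath_apply_target_ne p _ h, map_zero, zero_mul]

end Ring

variable [Field K] [Fintype V]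

instance : FiniteDimensional K (ConstantRep K V) :=
  Module.Finite.equiv (coord K V).symm

variable (K V) in
theorem isFullThin : IsFullThin K (V := V) (ConstantRep K V) := by
  classical
  constructor
  · intro a
    rw [finrank_eq_one_iff']
    let δ : ConstantRep K V := (coord K V).symm (Pi.single a 1)
    have hδ : coord K V δ = Pi.single a 1 := (coord K V).apply_symm_apply _
    have hmem : δ ∈ vertexSpace K (ConstantRep K V) a := by
      rw [mem_vertexSpace]
      refine ext_coord fun c => ?_
      by_cases hc : c = a
      · subst hc
        rw [coord_pathAct_target]
      · rw [coord_pathAct_of_ne _ _ hc, hδ, Pi.single_eq_of_ne hc]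
    refine ⟨⟨δ, hmem⟩, fun h => ?_, fun ⟨t, ht⟩ => ⟨coord K V t a, Subtype.ext ?_⟩⟩
    · have h₁ : δ = 0 := congrArg Subtype.val h
      rw [h₁, map_zero] at hδ
      simpa using congrFun hδ a
    · refine ext_coord fun c => ?_
      change coord K V (coord K V t a • δ) c = coord K V t c
      rw [map_smul, hδ]
      by_cases hc : c = a
      · subst hc
        simp
      · rw [← (mem_vertexSpace K).mp ht, coord_pathAct_of_ne _ _ hc]
        simp [hc]
  · intro a b α
    refine ⟨(coord K V).symm fun _ => 1, fun h => ?_⟩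
    have h₁ := coord_pathAct_target α.toPath ((coord K V).symm fun _ => (1 : K))
    rw [h, map_zero, LinearEquiv.apply_symm_apply] at h₁
    exact zero_ne_one h₁

end ConstantRep

end ConstantRepresentation

/-! ### Tops and second radical quotients of full thin modules. -/

section FactorSerial

variable {K : Type u} [Field K] {V : Type v} [Quiver.{w} V] [Fintype V]
  {M : Type*} [AddCommGroup M] [Module K M] [Module (PathAlgebra K V)ᵐᵒᵖ M]
  [IsScalarTower K (PathAlgebra K V)ᵐᵒᵖ M]

theorem isUniserialModule_quotient_radPow_zero {S M : Type*} [Ring S] [AddCommGroup M]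
    [Module S M] [IsNoetherian S M] [IsArtinian S M] :
    IsUniserialModule S (M ⧸ radPow S M 0) :=
  isUniserialModule_quotient_of_total fun _ _ hA _ => Or.inr (le_top.trans hA)

theorem le_radPow_one {S M : Type*} [Ring S] [AddCommGroup M] [Module S M] {N : Submodule S M}
    (hN : ∀ X : Submodule S M, IsCoatom X → N ≤ X) : N ≤ radPow S M 1 := by
  have h : (Module.jacobson S (⊤ : Submodule S M)).map (⊤ : Submodule S M).subtype =
      Module.jacobson S M :=
    Module.map_jacobson_of_bijective
      ⟨(⊤ : Submodule S M).injective_subtype, fun m => ⟨⟨m, trivial⟩, rfl⟩⟩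
  change N ≤ (Module.jacobson S (⊤ : Submodule S M)).map (⊤ : Submodule S M).subtype
  rw [h]
  exact le_sInf hN

namespace IsFullThin

variable (h : IsFullThin K (V := V) M)

include h

theorem vanishingOn_singleton_covBy {b : V}
    (hb : ∀ (x y : V), (x ⟶ y) → y ∈ ({b} : Set V) → x ∈ ({b} : Set V)) :
    vanishingOn K (M := M) {b} hb ⋖ (⊤ : Submodule (PathAlgebra K V)ᵐᵒᵖ M) := by
  have hempty : ∀ (x y : V), (x ⟶ y) → y ∈ (∅ : Set V) → x ∈ (∅ : Set V) := fun _ _ _ hy => hy.elim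
  have htop : (⊤ : Submodule (PathAlgebra K V)ᵐᵒᵖ M) =
      vanishingOn K ∅ hempty := by
    symm
    rw [eq_top_iff]
    exact fun m _ => (mem_vanishingOn K).mpr fun a ha => ha.elim
  have hb' : ∀ (x y : V), (x ⟶ y) → y ∈ insert b (∅ : Set V) → x ∈ insert b (∅ : Set V) := by
    simpa using hb
  have := h.vanishingOn_insert_covBy (hS := hempty) (Set.notMem_empty b) hb'
  rw [htop]
  simpa only [insert_empty_eq] using this

/-- If there is only one source then the top is simple. -/
theorem isUniserialModule_top [IsNoetherian (PathAlgebra K V)ᵐᵒᵖ M]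
    [IsArtinian (PathAlgebra K V)ᵐᵒᵖ M] {pos : V → ℕ} {n : ℕ} (H : IsTypeANumbering pos n)
    {b : V} (hsource : ∀ a : V, IsEmpty (a ⟶ b))
    (hb : ∀ a, a ≠ b → ∃ c : V, Nonempty (c ⟶ a)) :
    IsUniserialModule (PathAlgebra K V)ᵐᵒᵖ (M ⧸ radPow (PathAlgebra K V)ᵐᵒᵖ M 1) := by
  have hS : ∀ (x y : V), (x ⟶ y) → y ∈ ({b} : Set V) → x ∈ ({b} : Set V) := by
    rintro x _ α rfl
    exact (hsource x).elim α
  have hcov := h.vanishingOn_singleton_covBy hS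
  -- Every proper submodule vanishes at the only source, so this is the unique maximal submodule.
  have hrad : vanishingOn K (M := M) {b} hS ≤ radPow (PathAlgebra K V)ᵐᵒᵖ M 1 := by
    refine le_radPow_one fun X hX => ?_
    have hle := h.le_vanishingOn_of_ne_top H hb (hS := hS) hX.1
    exact ((hX.le_iff.mp hle).resolve_left hcov.lt.ne).le
  refine isUniserialModule_quotient_of_total fun A B hA hB => ?_
  by_cases hAt : A = ⊤
  · exact Or.inr (hAt ▸ le_top)
  · exact Or.inl ((h.le_vanishingOn_of_ne_top H hb (hS := hS) hAt).trans (hrad.trans hB))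

/-- If there are two sources then the top is not uniserial. -/
theorem not_isUniserialModule_top {s t : V} (hst : s ≠ t) (hs : ∀ a : V, IsEmpty (a ⟶ s))
    (ht : ∀ a : V, IsEmpty (a ⟶ t)) :
    ¬ IsUniserialModule (PathAlgebra K V)ᵐᵒᵖ (M ⧸ radPow (PathAlgebra K V)ᵐᵒᵖ M 1) := by
  intro huni
  have hclosed : ∀ b : V, (∀ a : V, IsEmpty (a ⟶ b)) →
      ∀ (x y : V), (x ⟶ y) → y ∈ ({b} : Set V) → x ∈ ({b} : Set V) := by
    rintro b hb x _ α rfl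
    exact (hb x).elim α
  have hle : ∀ (b : V) (hb : ∀ a : V, IsEmpty (a ⟶ b)),
      radPow (PathAlgebra K V)ᵐᵒᵖ M 1 ≤ vanishingOn K {b} (hclosed b hb) := fun b hb =>
    radPow_succ_le_of_covBy le_top (h.vanishingOn_singleton_covBy (hclosed b hb))
  rcases huni.total_of_quotient (hle s hs) (hle t ht) with hle | hle
  · exact h.not_vanishingOn_le (a := t) (fun h' => hst (Set.mem_singleton_iff.mp h').symm)
      (Set.mem_singleton t) hle
  · exact h.not_vanishingOn_le (a := s) (fun h' => hst (Set.mem_singleton_iff.mp h'))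
      (Set.mem_singleton s) hle

/-- If two vertices are reached only from the source `b`, then the quotient by the second power of
the radical is not uniserial. -/
theorem not_isUniserialModule_quotient_radPow_two {b c d : V} (hcd : c ≠ d) (hcb : c ≠ b)
    (hdb : d ≠ b) (hb : ∀ a : V, IsEmpty (a ⟶ b)) (hc : ∀ a : V, (a ⟶ c) → a = b)
    (hd : ∀ a : V, (a ⟶ d) → a = b) :
    ¬ IsUniserialModule (PathAlgebra K V)ᵐᵒᵖ (M ⧸ radPow (PathAlgebra K V)ᵐᵒᵖ M 2) := by
  intro huni
  have hS : ∀ (x y : V), (x ⟶ y) → y ∈ ({b} : Set V) → x ∈ ({b} : Set V) := by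
    rintro x _ α rfl
    exact (hb x).elim α
  have hclosed : ∀ e : V, (∀ a : V, (a ⟶ e) → a = b) →
      ∀ (x y : V), (x ⟶ y) → y ∈ insert e ({b} : Set V) → x ∈ insert e ({b} : Set V) := by
    intro e he x y α hy
    obtain rfl | hy := Set.mem_insert_iff.mp hy
    · exact Set.mem_insert_of_mem _ (he x α)
    · exact Set.mem_insert_of_mem _ (hS x y α hy)
  -- Removing `b` and then `e` is two covers below `⊤`, so the result contains the second radical
  -- power. The choices `e = c` and `e = d` are incomparable.
  have hle : ∀ (e : V) (he : ∀ a : V, (a ⟶ e) → a = b), e ≠ b →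
      radPow (PathAlgebra K V)ᵐᵒᵖ M 2 ≤ vanishingOn K (insert e {b}) (hclosed e he) :=
    fun e he heb => radPow_succ_le_of_covBy
      (radPow_succ_le_of_covBy le_top (h.vanishingOn_singleton_covBy hS))
      (h.vanishingOn_insert_covBy (fun h' => heb (Set.mem_singleton_iff.mp h')) (hclosed e he))
  rcases huni.total_of_quotient (hle c hc hcb) (hle d hd hdb) with hle | hle
  · exact h.not_vanishingOn_le (a := d) (by simp [hcd.symm, hdb]) (Set.mem_insert _ _) hle
  · exact h.not_vanishingOn_le (a := c) (by simp [hcd, hcb]) (Set.mem_insert _ _) hle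

end IsFullThin

/-- An indecomposable module over a path algebra of type `𝔸_n` has length at most `n`, with
equality only if all components are one-dimensional and all arrows act nontrivially. -/
theorem IsIndecomposableModule.length_le_and_isFullThin [FiniteDimensional K M] {pos : V → ℕ}
    {n : ℕ} (H : IsTypeANumbering pos n) [IsNoetherian (PathAlgebra K V)ᵐᵒᵖ M]
    [IsArtinian (PathAlgebra K V)ᵐᵒᵖ M] (hM : IsIndecomposableModule (PathAlgebra K V)ᵐᵒᵖ M) :
    Module.length (PathAlgebra K V)ᵐᵒᵖ M ≤ n ∧
      (Module.length (PathAlgebra K V)ᵐᵒᵖ M = n → IsFullThin K (V := V) M) := by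
  have hle : ∀ a : V, Module.finrank K (vertexSpace K M a) ≤ 1 :=
    hM.finrank_vertexSpace_le_one H
  have h₁ := length_le_finrank K (V := V) (M := M)
  have h₂ := finrank_le_sum_finrank_vertexSpace K (V := V) (M := M)
  have h₃ : ∑ a : V, Module.finrank K (vertexSpace K M a) ≤ ∑ _a : V, 1 :=
    Finset.sum_le_sum fun a _ => hle a
  have h₄ : ∑ _a : V, 1 = n := by simp [H.card_eq]
  refine ⟨h₁.trans (Nat.cast_le.mpr (by omega)), fun hlen => ?_⟩
  rw [hlen, Nat.cast_le] at h₁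
  have h₅ : ∀ a : V, Module.finrank K (vertexSpace K M a) = 1 := fun a =>
    (Finset.sum_eq_sum_iff_of_le fun a _ => hle a).mp (by omega) a (Finset.mem_univ a)
  refine ⟨h₅, fun α => hM.exists_pathAct_ne_zero H (fun a hbot => ?_) α⟩
  have := h₅ a
  rw [hbot, finrank_bot] at this
  omega

end FactorSerial

/-! ### The Nakayama property. -/

/-- A criterion for path algebras of type `𝔸_n` to be right `m`-Nakayama for `m = n` or
`m = n - 1`. -/
theorem isRightNakayama_of_isFactorSerial {K : Type u} [Field K] {V : Type v} [Fintype V]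
    [Quiver.{w} V] {pos : V → ℕ} {n m : ℕ} (H : IsTypeANumbering pos n) (hn : 0 < n) (hm : 0 < m)
    (hT : IsFactorSerial (PathAlgebra K V)ᵐᵒᵖ (ConstantRep K V) m)
    (hfull : ∀ (M : Type (max u v w)) [AddCommGroup M] [Module K M]
      [Module (PathAlgebra K V)ᵐᵒᵖ M] [IsScalarTower K (PathAlgebra K V)ᵐᵒᵖ M]
      [IsNoetherian (PathAlgebra K V)ᵐᵒᵖ M] [IsArtinian (PathAlgebra K V)ᵐᵒᵖ M],
      IsFullThin K (V := V) M → m < n →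
      IsUniserialModule (PathAlgebra K V)ᵐᵒᵖ (M ⧸ radPow (PathAlgebra K V)ᵐᵒᵖ M 1))
    (hmn : n ≤ m + 1) : IsRightNakayama K (PathAlgebra K V) m := by
  have := H.finite_path
  have hfin : Module.Finite K (PathAlgebra K V) := PathAlgebra.module_finite
  have hfin' : Module.Finite K (PathAlgebra K V)ᵐᵒᵖ :=
    Module.Finite.equiv (MulOpposite.opLinearEquiv K)
  refine ⟨⟨inferInstance, hfin⟩, ?_, ConstantRep K V, inferInstance, inferInstance,
    Module.Finite.of_restrictScalars_finite K _ _,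
    (ConstantRep.isFullThin K V).isIndecomposableModule hn H, hT⟩
  intro M _ _ _ hM
  -- Only the action of the path algebra is given; the vector space structure is its restriction to
  -- scalars.
  let _ : Module K M := Module.compHom M (algebraMap K (PathAlgebra K V)ᵐᵒᵖ)
  have _ : IsScalarTower K (PathAlgebra K V)ᵐᵒᵖ M := ⟨fun x f t => by
    rw [Algebra.smul_def, mul_smul]
    rfl⟩
  have _ : FiniteDimensional K M := Module.Finite.trans (PathAlgebra K V)ᵐᵒᵖ M
  have _ : IsNoetherian (PathAlgebra K V)ᵐᵒᵖ M := isNoetherian_of_tower K inferInstance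
  have _ : IsArtinian (PathAlgebra K V)ᵐᵒᵖ M := isArtinian_of_tower K inferInstance
  obtain ⟨hlen, hthin⟩ := hM.length_le_and_isFullThin (K := K) H
  obtain ⟨l, hl⟩ := ENat.ne_top_iff_exists.mp (Module.length_ne_top (R := (PathAlgebra K V)ᵐᵒᵖ)
    (M := M))
  rw [← hl, Nat.cast_le] at hlen
  obtain huni | ⟨i, hi, hil, hser⟩ := isUniserialModule_or_exists_isFactorSerial hl.symm
  · exact ⟨1, le_rfl, hm, Or.inl ⟨rfl, huni⟩⟩
  refine ⟨i, hi.le, ?_, hser⟩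
  by_contra! hmi
  obtain ⟨h1, -⟩ | ⟨-, l', hl', -, -, hnot⟩ := hser
  · omega
  have hll' : l = l' := by
    rw [← hl] at hl'
    exact_mod_cast hl'
  subst hll'
  -- From `n ≤ m + 1 ≤ i ≤ l ≤ n` all are equal, so `M` is full thin and its top is both uniserial
  -- by `hfull` and not uniserial by `hnot`.
  obtain rfl : i = n := by omega
  obtain rfl : l = i := by omega
  rw [Nat.sub_self, zero_add] at hnot
  exact hnot (hfull M (hthin hl.symm) hmi)

theorem proposition14 (K : Type u) [Field K] [IsAlgClosed K]
    (V : Type v) [Fintype V] [Quiver.{w} V] (n : ℕ) (hn : 0 < n) (hQ : IsTypeA V n) :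
    ((∀ a : V, ENat.card (Quiver.Costar a) ≤ 1) → (∃ b : V, ENat.card (Quiver.Star b) = 2) →
      IsRightNakayama K (PathAlgebra K V) (n - 1)) ∧
    ((∃ b : V, ENat.card (Quiver.Costar b) = 2) →
      IsRightNakayama K (PathAlgebra K V) n) := by
  obtain ⟨pos, H⟩ := hQ.exists_numbering
  have hT := ConstantRep.isFullThin K V
  have hlen := hT.length_eq H
  have _ := H.finite_path
  have _ : IsNoetherian (PathAlgebra K V)ᵐᵒᵖ (ConstantRep K V) :=
    isNoetherian_of_tower K inferInstance
  have _ : IsArtinian (PathAlgebra K V)ᵐᵒᵖ (ConstantRep K V) :=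
    isArtinian_of_tower K inferInstance
  refine ⟨fun hcostar ⟨b, hb⟩ => ?_, fun ⟨b, hb⟩ => ?_⟩
  · have hcostar' : ∀ a : V, Subsingleton (Costar a) := fun a =>
      (ENat.card_le_one_iff_subsingleton _).mp (hcostar a)
    have hstar : Nontrivial (Star b) := (ENat.one_lt_card_iff_nontrivial _).mp (by simp [hb])
    have hsource := fun s hs => H.exists_arrow_to hcostar' hstar (s := s) hs
    obtain ⟨⟨c, α⟩, ⟨d, β⟩, hne⟩ := hstar
    have hcd : c ≠ d := by
      rintro rfl
      exact hne (by rw [H.arrow_subsingleton α β])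
    have hpred : ∀ {e : V}, (b ⟶ e) → ∀ a : V, (a ⟶ e) → a = b := by
      intro e γ a δ
      have _ := hcostar' e
      exact congrArg Sigma.fst (Subsingleton.elim (⟨a, δ⟩ : Costar e) ⟨b, γ⟩)
    have hcb : c ≠ b := by
      rintro rfl
      exact H.no_two_cycle α α
    have hdb : d ≠ b := by
      rintro rfl
      exact H.no_two_cycle β β
    -- `b` has at most two neighbours, and both are used up by the outgoing arrows.
    have hbs : ∀ a : V, IsEmpty (a ⟶ b) := by
      refine fun a => ⟨fun γ => ?_⟩
      have h₁ := H.adjacent α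
      have h₂ := H.adjacent β
      have h₃ : pos c ≠ pos d := fun h => hcd (H.injective h)
      have h₄ := H.adjacent γ
      obtain h₅ | h₅ : pos a = pos c ∨ pos a = pos d := by omega
      · obtain rfl := H.injective h₅
        exact H.no_two_cycle α γ
      · obtain rfl := H.injective h₅
        exact H.no_two_cycle β γ
    -- Needed for `1 < n - 1`, the non-uniserial branch of `IsFactorSerial`.
    have hn3 : 3 ≤ n := by
      have h₁ := H.adjacent α
      have h₂ := H.adjacent β
      have h₃ : pos c ≠ pos d := fun h => hcd (H.injective h)
      have h₄ := H.lt c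
      have h₅ := H.lt d
      omega
    refine isRightNakayama_of_isFactorSerial H hn (by omega) ?_
      (fun M _ _ _ _ _ _ hM _ => hM.isUniserialModule_top H hbs hsource) (by omega)
    refine Or.inr ⟨by omega, n, hlen, by omega, ?_, ?_⟩
    · rw [show n - (n - 1) = 1 by omega]
      exact hT.isUniserialModule_top H hbs hsource
    · rw [show n - (n - 1) + 1 = 2 by omega]
      exact hT.not_isUniserialModule_quotient_radPow_two hcd hcb hdb hbs (hpred α) (hpred β)
  · have hcostar : Nontrivial (Costar b) := (ENat.one_lt_card_iff_nontrivial _).mp (by simp [hb])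
    obtain ⟨s, t, hst, hs, ht⟩ := H.exists_two_sources hcostar
    have hn1 : 1 < n := by
      have h₁ : pos s ≠ pos t := fun h => hst (H.injective h)
      have h₂ := H.lt s
      have h₃ := H.lt t
      omega
    refine isRightNakayama_of_isFactorSerial H hn hn ?_
      (fun M _ _ _ _ _ _ _ hlt => absurd hlt (lt_irrefl n)) (by omega)
    refine Or.inr ⟨hn1, n, hlen, le_rfl, ?_, ?_⟩
    · rw [Nat.sub_self]
      exact isUniserialModule_quotient_radPow_zero
    · rw [Nat.sub_self, zero_add]
      exact hT.not_isUniserialModule_top hst hs ht
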